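/- For a finite simple graph $G$, a connected dominating set is a vertex set $D$ that induces a (nonempty) connected subgraph and such that every vertex is in $D$ or has a neighbour in $D$; $\mathbf{cds}(G)$ is the smallest size of such a set ($\infty$ if there is none). A set $Z\subseteq V(G)$ is a $k$-domination core if every set $D$ of at most $k$ vertices that dominates $Z$ dominates $V(G)$. For $Z\subseteq V(G)$ and $u,v\in V(G)\setminus Z$ write $u\sim_Z v$ if $N(u)\cap Z=N(v)\cap Z$; the neighborhood complexity function of $G$ is $\mu_G(z)=\max_{|Z|=z}\mathrm{index}(\sim_Z)$ (and $0$ for $z>|V(G)|$). For an instance $(G,k)$ and $S\subseteq V(G)$ let $\mathrm{CDS}(G,k,S)=\min\{|S|,k+1\}$ if $S$ is a connected dominating set of $G$, and $\infty$ otherwise, and let $\mathrm{OPT}(G,k)=\min_S\mathrm{CDS}(G,k,S)$. Running times are measured in the size of the input, with numbers written in unary. There is an absolute constant $c$, and for every real polynomial $p$ of degree at most $d$, $d\ge 1$, there is a constant $K$, such that the following holds. Let $\mathcal C$ be a class of graphs with $\mu_G(z)\le p(z)$ for all $G\in\mathcal C$ and $z\in\mathbb N$, and let $A$ be a polynomial-time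 algorithm that on input $(G,k)$ with $G\in\mathcal C$ either correctly reports that $\mathbf{cds}(G)>k$ or returns a $k$-domination core $Z=Z(G,k)$ of $G$. Then for every $\epsilon>0$, Connected Dominating Set parameterized by $k$ admits a $(1+\epsilon)$-approximate kernel on $\mathcal C$ with $(K|Z|)^{c\,d\lceil 1/\epsilon\rceil}$ vertices (so $|Z|^{\mathcal O(d/\epsilon)}$ vertices for $\epsilon\le 1$ and $|Z|\ge 2$, the hidden constant depending only on $p$). That is, there are a polynomial-time reduction algorithm, which maps each $(G,k)$ with $G\in\mathcal C$ to an instance $(G',k')$, where $G'$ is isomorphic to an induced subgraph of $G$ and $k'\le k$, and a polynomial-time solution lifting algorithm, which maps $(G,k)$, $(G',k')$ and any $S'\subseteq V(G')$ to a set $S\subseteq V(G)$, such that $$\frac{\mathrm{CDS}(G,k,S)}{\mathrm{OPT}(G,k)}\le(1+\epsilon)\,\frac{\mathrm{CDS}(G',k',S')}{\mathrm{OPT}(G',k')}$$ (with $\infty/\infty=0$, so that nothing is asked if $G$ has no connected dominating set, while $G'$ must have one whenever $G$ has one), and such that $|V(G')|\le(K|Z|)^{c\,d\lceil 1/\epsilon\rceil}$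 if $A$ returns the core $Z$ on $(G,k)$, and $|V(G')|\le 1$ if $A$ reports $\mathbf{cds}(G)>k$. -/

import Mathlib

namespace LossyCDS

/-! ### Polynomial time

Data are binary trees.  Programs form a first-order language of tree functions with `while` loops.
The running time adds up the sizes of all the trees that are written plus one unit for every
control step.  Hence a run of time `t` on an input of size `s` performs at most `t` elementary steps
on trees of size at most `max s t`, and a Turing machine follows it in time polynomial in `s + t`;
conversely the language simulates a Turing machine with polynomial overhead. -/

/-- Binary trees. -/
inductive Data : Type
  | nil : Data
  | cons : Data → Data → Data

namespace Data

/-- The number of nodes. -/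
def size : Data → ℕ
  | nil => 1
  | cons a b => a.size + b.size + 1

/-- First component (`nil` has none and is mapped to `nil`). -/
def hd : Data → Data
  | nil => nil
  | cons a _ => a

/-- Second component (`nil` has none and is mapped to `nil`). -/
def tl : Data → Data
  | nil => nil
  | cons _ b => b

/-- A list of trees as a tree. -/
def ofList : List Data → Data
  | [] => nil
  | a :: l => cons a (ofList l)

end Data

/-- Programs; each one denotes a partial function from trees to trees. -/
inductive Prog : Type
  /-- return the input -/
  | id : Prog
  /-- return `nil` -/
  | nil : Prog
  /-- return the first component of the input -/
  | hd : Prog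
  /-- return the second component of the input -/
  | tl : Prog
  /-- run both programs on the input and pair the results -/
  | pair : Prog → Prog → Prog
  /-- `comp f g` runs `g` on the input, and `f` on the result -/
  | comp : Prog → Prog → Prog
  /-- `ite c f g` runs `f` if `c` returns a non-`nil` tree, and `g` otherwise -/
  | ite : Prog → Prog → Prog → Prog
  /-- `loop c f` replaces the current tree `x` by `f x` as long as `c x` is not `nil` -/
  | loop : Prog → Prog → Prog

/-- `Runs f x y t`: the program `f` halts on input `x` with output `y`, after time `t`. -/
inductive Runs : Prog → Data → Data → ℕ → Prop
  | id (x : Data) : Runs Prog.id x x x.size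
  | nil (x : Data) : Runs Prog.nil x Data.nil Data.nil.size
  | hd (x : Data) : Runs Prog.hd x x.hd x.hd.size
  | tl (x : Data) : Runs Prog.tl x x.tl x.tl.size
  | pair {f g : Prog} {x y z : Data} {s t : ℕ} :
      Runs f x y s → Runs g x z t →
      Runs (Prog.pair f g) x (Data.cons y z) (s + t + (Data.cons y z).size)
  | comp {f g : Prog} {x y z : Data} {s t : ℕ} :
      Runs g x y s → Runs f y z t → Runs (Prog.comp f g) x z (s + t + 1)
  | ite_true {c f g : Prog} {x a b y : Data} {s t : ℕ} :
      Runs c x (Data.cons a b) s → Runs f x y t → Runs (Prog.ite c f g) x y (s + t + 1)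
  | ite_false {c f g : Prog} {x y : Data} {s t : ℕ} :
      Runs c x Data.nil s → Runs g x y t → Runs (Prog.ite c f g) x y (s + t + 1)
  | loop_done {c f : Prog} {x : Data} {s : ℕ} :
      Runs c x Data.nil s → Runs (Prog.loop c f) x x (s + 1)
  | loop_step {c f : Prog} {x a b y z : Data} {s t u : ℕ} :
      Runs c x (Data.cons a b) s → Runs f x y t → Runs (Prog.loop c f) y z u →
      Runs (Prog.loop c f) x z (s + t + u + 1)

/-- A fixed representation of the elements of `α` as trees. -/
class Enc (α : Type) where
  /-- the tree that represents an element -/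
  enc : α → Data

open Enc (enc)

/-- The function `f` is computable in polynomial time on the inputs in `D`: a single program
computes it there, in time bounded by a polynomial in the size of the encoded input. -/
def PolyTimeOn {α : Type} {β : α → Type} [Enc α] [∀ a, Enc (β a)] (D : Set α)
    (f : (a : α) → β a) : Prop :=
  ∃ (c : Prog) (p : Polynomial ℕ), ∀ a ∈ D, ∃ t : ℕ,
    Runs c (enc a) (enc (f a)) t ∧ t ≤ p.eval (enc a).size

/-! ### Graphs, instances and their representation -/

/-- A finite simple graph with vertices `0, …, n - 1`. -/
structure FinGraph : Type where
  /-- the number of vertices -/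
  n : ℕ
  /-- the graph -/
  graph : SimpleGraph (Fin n)

/-- An instance of a parameterized graph problem: a graph and the parameter. -/
structure Instance : Type where
  /-- the graph -/
  G : FinGraph
  /-- the parameter -/
  k : ℕ

/-- Truth values. -/
instance : Enc Bool where
  enc b := if b then Data.cons Data.nil Data.nil else Data.nil

/-- Natural numbers in unary. -/
instance : Enc ℕ where
  enc k := Data.ofList (List.replicate k Data.nil)

/-- Vertex sets by their characteristic vectors. -/
instance (n : ℕ) : Enc (Finset (Fin n)) where
  enc S := Data.ofList (List.ofFn fun i : Fin n => enc (decide (i ∈ S)))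

/-- Optional values. -/
instance (α : Type) [Enc α] : Enc (Option α) where
  enc
    | none => Data.nil
    | some a => Data.cons (enc a) Data.nil

open Classical in
/-- Graphs by their adjacency matrices. -/
noncomputable instance : Enc FinGraph where
  enc G := Data.ofList (List.ofFn fun i : Fin G.n =>
    Data.ofList (List.ofFn fun j : Fin G.n => enc (decide (G.graph.Adj i j))))

/-- Instances. -/
noncomputable instance : Enc Instance where
  enc I := Data.cons (enc I.G) (enc I.k)

/-! ### Domination -/

section Domination

variable {V : Type} (G : SimpleGraph V)

/-- `D` dominates `Z`: every vertex of `Z` is in `D` or has a neighbour in `D`. -/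
def Dominates (D Z : Finset V) : Prop :=
  ∀ v ∈ Z, v ∈ D ∨ ∃ u ∈ D, G.Adj u v

/-- `D` is a connected dominating set. -/
def IsCDS [Fintype V] (D : Finset V) : Prop :=
  (G.induce (D : Set V)).Connected ∧ Dominates G D Finset.univ

/-- The size of a smallest connected dominating set (`⊤` if there is none). -/
noncomputable def cds [Fintype V] : ℕ∞ :=
  ⨅ D : {D : Finset V // IsCDS G D}, (D.1.card : ℕ∞)

/-- `Z` is a `k`-domination core. -/
def IsDomCore [Fintype V] (k : ℕ) (Z : Finset V) : Prop :=
  ∀ D : Finset V, D.card ≤ k → Dominates G D Z → Dominates G D Finset.univ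

/-- The vertices outside `Z` are equivalent if they have the same neighbours in `Z`. -/
def simZ (Z : Finset V) : Setoid {v : V // v ∉ Z} :=
  Setoid.ker fun v => G.neighborSet v.1 ∩ (Z : Set V)

/-- The neighbourhood complexity function: the largest number of classes of `simZ G Z` over the
vertex sets `Z` of size `z`. -/
noncomputable def nbhdComplexity [Fintype V] (z : ℕ) : ℕ :=
  (Finset.univ.powersetCard z).sup fun Z : Finset V => Nat.card (Quotient (simZ G Z))

end Domination

/-! ### Parameterized minimization problems and lossy kernels -/

/-- A vertex-subset problem: which vertex sets of a graph are valid solutions. -/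
abbrev VertexSubsetProblem : Type := (G : FinGraph) → Finset (Fin G.n) → Prop

/-- Connected Dominating Set. -/
def CDS : VertexSubsetProblem := fun G S => IsCDS G.graph S

open Classical in
/-- The value of the solution `S` of an instance: infinite if `S` is not valid, and its size capped
at `k + 1` otherwise. -/
noncomputable def value (Q : VertexSubsetProblem) (I : Instance) (S : Finset (Fin I.G.n)) :
    ENNReal :=
  if Q I.G S then ((min S.card (I.k + 1) : ℕ) : ENNReal) else ⊤

/-- The optimum value of an instance. -/
noncomputable def opt (Q : VertexSubsetProblem) (I : Instance) : ENNReal :=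
  ⨅ S : Finset (Fin I.G.n), value Q I S

/-- The input of a solution lifting algorithm: the original instance, the reduced instance, and a
solution of the reduced one. -/
structure LiftInput : Type where
  /-- the original instance -/
  orig : Instance
  /-- the reduced instance -/
  red : Instance
  /-- a vertex set of the reduced graph -/
  sol : Finset (Fin red.G.n)

/-- Inputs of lifting algorithms. -/
noncomputable instance : Enc LiftInput where
  enc x := Data.cons (enc x.orig) (Data.cons (enc x.red) (enc x.sol))

/-- `(R, L)` is an `α`-approximate polynomial time pre-processing algorithm for `Q` on the graphs of
the class `𝒞`: the reduction algorithm `R` and the solution lifting algorithm `L` run in polynomial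
time, and `L` turns solutions of the reduced instance into solutions of the original instance whose
approximation ratio is worse by a factor of at most `α`.  In `ENNReal` we have `⊤ / ⊤ = 0`: nothing
is asked about instances without valid solutions, and an instance with valid solutions is never
reduced to one without. -/
def IsApproxPreprocessing (Q : VertexSubsetProblem) (𝒞 : Set FinGraph) (α : ℝ)
    (R : Instance → Instance) (L : (x : LiftInput) → Finset (Fin x.orig.G.n)) : Prop :=
  PolyTimeOn {I : Instance | I.G ∈ 𝒞} R ∧
  PolyTimeOn {x : LiftInput | x.orig.G ∈ 𝒞 ∧ x.red = R x.orig} L ∧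
  ∀ I : Instance, I.G ∈ 𝒞 → ∀ S : Finset (Fin (R I).G.n),
    value Q I (L ⟨I, R I, S⟩) / opt Q I ≤
      ENNReal.ofReal α * (value Q (R I) S / opt Q (R I))

/-- An algorithm that, for every graph of `𝒞` and every `k`, either reports (by `none`) that the
graph has no connected dominating set of size at most `k`, or returns a `k`-domination core. -/
def IsCoreAlgorithm (𝒞 : Set FinGraph)
    (A : (I : Instance) → Option (Finset (Fin I.G.n))) : Prop :=
  PolyTimeOn {I : Instance | I.G ∈ 𝒞} A ∧
  ∀ I : Instance, I.G ∈ 𝒞 →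
    (A I = none → (I.k : ℕ∞) < cds I.G.graph) ∧
    (∀ Z, A I = some Z → IsDomCore I.G.graph I.k Z)

end LossyCDS

/-!
# A lossy kernel for Connected Dominating Set from a domination core

Fix a core `Z` and call two vertices twins if they have the same neighbours in `Z`, and are equal if
one of them is in `Z`.  Let `N = ⌈1 / ε⌉` and `t = 5 * N`.  The reduced graph is induced by a set
`X`.  It consists of `Z` and, for every `s` from `1` to `4 * t`, of the entries of one list from
each class of entrywise twin lists among the lists of `s` vertices in which every entry except for the
last one equals or is adjacent to a later one (`connLists`, `keptLists`, `keptVerts`).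
There are at most `|Z| + μ(|Z|)` classes of twins, which bounds the number of lists that are kept
and hence `|X|` (`length_keptVerts_le`, `n_reduction_le`).

Let `D` be a connected dominating set with at most `k` vertices.  The vertices of `D` that are in
`Z` or have a neighbour in `Z` dominate `Z`, hence by the core property the whole graph; so every
`v ∈ D` equals or is adjacent to an *anchor* in `D`, which in turn equals or is adjacent to a
*connector* in `Z`.  Any twin of the anchor equals or is adjacent to the same connector.  Cutting a
tree that spans `D` from the leaves upwards gives at most `|D| / t` pieces and a remainder, of at
most `2 * t` vertices each, such that the pieces overlap only in their roots
(`HasRootedTree.exists_pieces`).  To a piece one adds the anchors of its root and of the roots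
below it that it contains; it is then replaced by twins inside `X`, and the connectors of these
roots keep the replacements connected to each other (`exists_replacement`).  Every cut costs at most
five additional vertices, so the result `D'` has at most `(1 + 1 / N) * |D|` of them.
It contains a twin of each vertex of `D`; there are at most `k` of these twins and they dominate
`Z`, hence they dominate the graph (`exists_isCDS_subset`).

If `X` does not induce a connected graph, it follows that there is no connected dominating set of
size at most `k`, and a single vertex serves as the reduced graph, just as when the core algorithm
finds no solution.  A connected dominating set of the reduced graph with at most `k` vertices
dominates `Z`, hence the original graph, and is lifted to itself; otherwise the set of all vertices
is a solution of value at most `k + 1` (`value_lifting_le`, `isApproxPreprocessing`).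

All lists of at most `4 * t` vertices can be enumerated in polynomial time since `t` is a constant.
The predicate `Poly` says that a function between types with a representation by trees is computable
in polynomial time; it is closed under composition, case distinction, folds over lists with small
intermediate results (`Poly.foldl`), and hence under `map`, `filter`, `any` and so on, so that
`fun_prop` derives the running times from the definitions of the functions.
-/

namespace LossyCDS

open Enc (enc)

/-! ### A calculus of polynomial-time functions -/

section Poly

variable {α β γ : Type} [Enc α] [Enc β] [Enc γ]

theorem Runs.size_le {c : Prog} {x y : Data} {t : ℕ} (h : Runs c x y t) :
    y.size ≤ x.size + t := by
  induction h <;> (try simp only [Data.size] at *) <;> omega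

theorem eval_mono (p : Polynomial ℕ) : Monotone fun x => p.eval x := by
  intro x y h
  simp only [Polynomial.eval_eq_sum, Polynomial.sum]
  gcongr

/-- `PolyTimeOn` for functions whose codomain does not depend on the argument. -/
def PolyOn (D : Set α) (f : α → β) : Prop := PolyTimeOn D f

/-- `f` is computable in polynomial time on all inputs. -/
@[fun_prop]
def Poly (f : α → β) : Prop := PolyOn Set.univ f

theorem PolyOn.mono {D E : Set α} {f : α → β} (hf : PolyOn E f) (h : D ⊆ E) : PolyOn D f := by
  obtain ⟨c, p, hc⟩ := hf
  exact ⟨c, p, fun a ha => hc a (h ha)⟩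

theorem Poly.on {f : α → β} (hf : Poly f) (D : Set α) : PolyOn D f := hf.mono (Set.subset_univ _)

theorem PolyOn.comp {D : Set α} {E : Set β} {f : β → γ} {g : α → β} (hf : PolyOn E f)
    (hg : PolyOn D g) (h : Set.MapsTo g D E) : PolyOn D fun a => f (g a) := by
  obtain ⟨cf, p, hf⟩ := hf
  obtain ⟨cg, q, hg⟩ := hg
  refine ⟨.comp cf cg, q + p.comp (Polynomial.X + q) + 1, fun a ha => ?_⟩
  obtain ⟨s, hs, hs'⟩ := hg a ha
  obtain ⟨t, ht, ht'⟩ := hf (g a) (h ha)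
  refine ⟨_, .comp hs ht, ?_⟩
  have := eval_mono p (hs.size_le.trans (Nat.add_le_add_left hs' _))
  simp at this ⊢
  omega

theorem Data.size_hd_le (x : Data) : x.hd.size ≤ x.size := by
  cases x <;> simp [Data.hd, Data.size]; omega

theorem Data.size_tl_le (x : Data) : x.tl.size ≤ x.size := by
  cases x <;> simp [Data.tl, Data.size]; omega

theorem Data.one_le_size (x : Data) : 1 ≤ x.size := by
  cases x <;> simp [Data.size]

theorem PolyOn.of_hd {D : Set α} {f : α → β} (h : ∀ a ∈ D, enc (f a) = (enc a).hd) :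
    PolyOn D f := by
  refine ⟨.hd, .X, fun a ha => ⟨(enc a).hd.size, ?_, ?_⟩⟩
  · rw [h a ha]; exact .hd _
  · simpa using Data.size_hd_le _

theorem PolyOn.of_tl {D : Set α} {f : α → β} (h : ∀ a ∈ D, enc (f a) = (enc a).tl) :
    PolyOn D f := by
  refine ⟨.tl, .X, fun a ha => ⟨(enc a).tl.size, ?_, ?_⟩⟩
  · rw [h a ha]; exact .tl _
  · simpa using Data.size_tl_le _

/-- A change of type that leaves the encoding as it is. -/
theorem Poly.of_enc_eq {f : α → β} (h : ∀ a, enc (f a) = enc a) : Poly f :=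
  ⟨.id, .X, fun a _ => ⟨(enc a).size, by rw [h a]; exact .id _, by simp⟩⟩

@[fun_prop]
theorem Poly.id : Poly fun a : α => a := .of_enc_eq fun _ => rfl

@[fun_prop]
theorem Poly.comp {f : β → γ} {g : α → β} (hf : Poly f) (hg : Poly g) :
    Poly fun a => f (g a) :=
  PolyOn.comp hf hg (Set.mapsTo_univ _ _)

@[fun_prop]
theorem Poly.const (b : β) : Poly fun _ : α => b := by
  have key : ∀ d : Data, ∃ (c : Prog) (m : ℕ), ∀ x, ∃ t, Runs c x d t ∧ t ≤ m := by
    intro d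
    induction d with
    | nil => exact ⟨.nil, 1, fun x => ⟨_, .nil x, le_rfl⟩⟩
    | cons a b iha ihb =>
      obtain ⟨c, m, h⟩ := iha
      obtain ⟨c', m', h'⟩ := ihb
      refine ⟨.pair c c', m + m' + (Data.cons a b).size, fun x => ?_⟩
      obtain ⟨s, hs, hs'⟩ := h x
      obtain ⟨t, ht, ht'⟩ := h' x
      exact ⟨_, .pair hs ht, by omega⟩
  obtain ⟨c, m, h⟩ := key (enc b)
  exact ⟨c, m, fun a _ => by simpa using h (enc a)⟩

/-- A pair is represented by the node over its components. -/
instance : Enc (α × β) where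
  enc x := Data.cons (enc x.1) (enc x.2)

theorem enc_pair (x : α × β) : enc x = Data.cons (enc x.1) (enc x.2) := rfl

theorem PolyOn.pair {D : Set α} {f : α → β} {g : α → γ} (hf : PolyOn D f) (hg : PolyOn D g) :
    PolyOn D fun a => (f a, g a) := by
  obtain ⟨cf, p, hf⟩ := hf
  obtain ⟨cg, q, hg⟩ := hg
  refine ⟨.pair cf cg, 2 * p + 2 * q + 2 * Polynomial.X + 1, fun a ha => ?_⟩
  obtain ⟨s, hs, hs'⟩ := hf a ha
  obtain ⟨t, ht, ht'⟩ := hg a ha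
  refine ⟨_, .pair hs ht, ?_⟩
  have h1 := hs.size_le
  have h2 := ht.size_le
  simp [Data.size]
  omega

@[fun_prop]
theorem Poly.pair {f : α → β} {g : α → γ} (hf : Poly f) (hg : Poly g) :
    Poly fun a => (f a, g a) := PolyOn.pair hf hg

@[fun_prop]
theorem Poly.fst {f : α → β × γ} (hf : Poly f) : Poly fun a => (f a).1 :=
  Poly.comp (f := Prod.fst) (PolyOn.of_hd fun _ _ => rfl) hf

@[fun_prop]
theorem Poly.snd {f : α → β × γ} (hf : Poly f) : Poly fun a => (f a).2 :=
  Poly.comp (f := Prod.snd) (PolyOn.of_tl fun _ _ => rfl) hf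

theorem PolyOn.cond {D : Set α} {b : α → Bool} {f g : α → β} (hb : PolyOn D b) (hf : PolyOn D f)
    (hg : PolyOn D g) : PolyOn D fun a => bif b a then f a else g a := by
  obtain ⟨cb, r, hb⟩ := hb
  obtain ⟨cf, p, hf⟩ := hf
  obtain ⟨cg, q, hg⟩ := hg
  refine ⟨.ite cb cf cg, r + p + q + 1, fun a ha => ?_⟩
  obtain ⟨u, hu, hu'⟩ := hb a ha
  obtain ⟨s, hs, hs'⟩ := hf a ha
  obtain ⟨t, ht, ht'⟩ := hg a ha
  cases h : b a
  · rw [h] at hu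
    exact ⟨_, by simpa [h] using .ite_false hu ht, by simp; omega⟩
  · rw [h] at hu
    exact ⟨_, by simpa [h] using .ite_true hu hs, by simp; omega⟩

@[fun_prop]
theorem Poly.cond {b : α → Bool} {f g : α → β} (hb : Poly b) (hf : Poly f) (hg : Poly g) :
    Poly fun a => bif b a then f a else g a := PolyOn.cond hb hf hg

@[fun_prop]
theorem Poly.and {f g : α → Bool} (hf : Poly f) (hg : Poly g) : Poly fun a => f a && g a := by
  have : (fun a => f a && g a) = fun a => bif f a then g a else false := by
    funext a; cases f a <;> rfl
  rw [this]; fun_prop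

@[fun_prop]
theorem Poly.or {f g : α → Bool} (hf : Poly f) (hg : Poly g) : Poly fun a => f a || g a := by
  have : (fun a => f a || g a) = fun a => bif f a then true else g a := by
    funext a; cases f a <;> rfl
  rw [this]; fun_prop

@[fun_prop]
theorem Poly.not {f : α → Bool} (hf : Poly f) : Poly fun a => !f a := by
  have : (fun a => !f a) = fun a => bif f a then false else true := by
    funext a; cases f a <;> rfl
  rw [this]; fun_prop

/-- A list is represented by the list of the representations of its entries. -/
instance : Enc (List α) where
  enc l := Data.ofList (l.map enc)

/-- The unit is represented by the leaf, so that lists of units look like natural numbers. -/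
instance : Enc Unit where
  enc _ := Data.nil

theorem enc_nil : enc ([] : List α) = Data.nil := rfl

theorem enc_cons (a : α) (l : List α) : enc (a :: l) = Data.cons (enc a) (enc l) := rfl

@[fun_prop]
theorem Poly.cons {f : α → β} {g : α → List β} (hf : Poly f) (hg : Poly g) :
    Poly fun a => f a :: g a :=
  Poly.comp (f := fun x : β × List β => x.1 :: x.2) (.of_enc_eq fun _ => rfl) (hf.pair hg)

@[fun_prop]
theorem Poly.tail {f : α → List β} (hf : Poly f) : Poly fun a => (f a).tail :=
  Poly.comp (f := List.tail) (PolyOn.of_tl fun l _ => by cases l <;> rfl) hf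

@[fun_prop]
theorem Poly.isEmpty {f : α → List β} (hf : Poly f) : Poly fun a => (f a).isEmpty := by
  refine Poly.comp (f := List.isEmpty) (g := f) ?_ hf
  refine ⟨.ite .id .nil (.pair .nil .nil), Polynomial.X + 10, fun l _ => ?_⟩
  cases l with
  | nil => exact ⟨_, .ite_false (.id _) (.pair (.nil _) (.nil _)), by simp [Data.size]⟩
  | cons a l => exact ⟨_, .ite_true (.id _) (.nil _), by simp [Data.size, enc_cons]⟩

/-- The default element is represented by the leaf.  This is what
reading the first entry of an empty list yields. -/
class NilEnc (α : Type) [Enc α] [Inhabited α] : Prop where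
  enc_default : enc (default : α) = Data.nil

instance : NilEnc ℕ := ⟨rfl⟩
instance : NilEnc Bool := ⟨rfl⟩
instance : NilEnc (List α) := ⟨rfl⟩

@[fun_prop]
theorem Poly.headI [Inhabited β] [NilEnc β] {f : α → List β} (hf : Poly f) :
    Poly fun a => (f a).headI :=
  Poly.comp (f := List.headI)
    (PolyOn.of_hd fun l _ => by cases l <;> simp [enc_nil, enc_cons, Data.hd, NilEnc.enc_default])
    hf

/-- A loop whose states stay polynomially small, with polynomially many rounds, runs in polynomial
time. -/
theorem exists_loop {c : α → Bool} {f : α → α} (hc : Poly c) (hf : PolyOn {s | c s = true} f) :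
    ∃ (w : Prog) (p : Polynomial ℕ), ∀ (n N : ℕ) (s : α), (∀ j < n, c (f^[j] s) = true) →
      c (f^[n] s) = false → (∀ j ≤ n, (enc (f^[j] s)).size ≤ N) →
      ∃ t, Runs w (enc s) (enc (f^[n] s)) t ∧ t ≤ (n + 1) * p.eval N := by
  obtain ⟨cc, p, hc⟩ := hc
  obtain ⟨cf, q, hf⟩ := hf
  refine ⟨.loop cc cf, p + q + 1, fun n N => ?_⟩
  induction n with
  | zero =>
    intro s _ h0 hN
    obtain ⟨t, ht, ht'⟩ := hc s trivial
    simp only [Function.iterate_zero, id] at h0 hN ⊢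
    rw [h0] at ht
    refine ⟨_, .loop_done ht, ?_⟩
    have := eval_mono p (hN 0 le_rfl)
    simp at this ⊢
    omega
  | succ n ih =>
    intro s h1 h0 hN
    obtain ⟨t, ht, ht'⟩ := hc s trivial
    have hs : c s = true := h1 0 (by omega)
    obtain ⟨u, hu, hu'⟩ := hf s hs
    obtain ⟨v, hv, hv'⟩ := ih (f s) (fun j hj => h1 (j + 1) (by omega)) h0
      (fun j hj => hN (j + 1) (by omega))
    rw [hs] at ht
    refine ⟨_, .loop_step ht hu hv, ?_⟩
    have h2 := eval_mono p (hN 0 (by omega))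
    have h3 := eval_mono q (hN 0 (by omega))
    simp at h2 h3 hv' ⊢
    nlinarith

theorem Data.size_ofList_append (l m : List Data) :
    (Data.ofList (l ++ m)).size + 1 = (Data.ofList l).size + (Data.ofList m).size := by
  induction l with
  | nil => simp [Data.ofList, Data.size]; omega
  | cons a l ih => simp [Data.ofList, Data.size]; omega

theorem size_enc_append (l m : List α) :
    (enc (l ++ m)).size + 1 = (enc l).size + (enc m).size := by
  simpa [enc] using Data.size_ofList_append (l.map enc) (m.map enc)

theorem length_le_size (l : List α) : l.length ≤ (enc l).size := by
  induction l with
  | nil => simp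
  | cons a l ih => simp [enc_cons, Data.size]; omega

theorem size_le_of_mem {l : List α} {a : α} (h : a ∈ l) : (enc a).size ≤ (enc l).size := by
  induction l with
  | nil => simp at h
  | cons b l ih =>
    simp only [enc_cons, Data.size]
    rcases List.mem_cons.1 h with rfl | h
    · omega
    · have := ih h; omega

/-- Lists of a bounded number of small entries are small. -/
theorem size_enc_le_of_forall {l : List α} {N : ℕ} (h : ∀ a ∈ l, (enc a).size ≤ N) :
    (enc l).size ≤ l.length * (N + 1) + 1 := by
  induction l with
  | nil => simp [enc_nil, Data.size]
  | cons a l ih =>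
    have h1 := h a (by simp)
    have h2 := ih fun b hb => h b (by simp [hb])
    simp only [enc_cons, Data.size, List.length_cons]
    nlinarith

/-- Folding over a list takes polynomial time if all intermediate results are polynomially small. -/
theorem Poly.foldl [Inhabited β] {l : α → List β} {s : α → γ} {g : α → γ → β → γ} (hl : Poly l)
    (hs : Poly s) (hg : Poly fun x : α × β × γ => g x.1 x.2.2 x.2.1) (q : Polynomial ℕ)
    (hq : ∀ a m, m <+: l a → (enc (m.foldl (g a) (s a))).size ≤ q.eval (enc a).size) :
    Poly fun a => (l a).foldl (g a) (s a) := by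
  have hc : Poly fun x : α × List β × γ => !x.2.1.isEmpty := by fun_prop
  have hhead : PolyOn {l : List β | l.isEmpty = false} List.headI :=
    PolyOn.of_hd fun l hl => by
      cases l with
      | nil => simp at hl
      | cons => rfl
  have hstep : PolyOn {x : α × List β × γ | (!x.2.1.isEmpty) = true}
      fun x => (x.1, x.2.1.tail, g x.1 x.2.2 x.2.1.headI) := by
    refine PolyOn.pair (Poly.on (by fun_prop) _) (PolyOn.pair (Poly.on (by fun_prop) _) ?_)
    refine PolyOn.comp (g := fun x : α × List β × γ => (x.1, x.2.1.headI, x.2.2)) hg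
      ?_ (Set.mapsTo_univ _ _)
    refine PolyOn.pair (Poly.on (by fun_prop) _) (PolyOn.pair ?_ (Poly.on (by fun_prop) _))
    refine PolyOn.comp (g := fun x : α × List β × γ => x.2.1) hhead (Poly.on (by fun_prop) _) ?_
    intro x hx
    simpa using hx
  obtain ⟨w, p, hw⟩ := exists_loop hc hstep
  obtain ⟨ci, pi, hi⟩ : Poly fun a => (a, l a, s a) := by fun_prop
  have hlen := hl
  obtain ⟨cl, pl, hlen⟩ := hlen
  -- the state after `j` rounds of the loop
  have hiter : ∀ (a : α) (j : ℕ) (m : List β) (c : γ), j ≤ m.length →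
      (fun x : α × List β × γ => (x.1, x.2.1.tail, g x.1 x.2.2 x.2.1.headI))^[j] (a, m, c)
        = (a, m.drop j, (m.take j).foldl (g a) c) := by
    intro a j
    induction j with
    | zero => intro m c _; simp
    | succ j ih =>
      intro m c h
      cases m with
      | nil => simp at h
      | cons b m =>
        rw [Function.iterate_succ_apply, ih _ _ (by simpa using h)]
        simp
  have hout : PolyOn Set.univ fun x : α × List β × γ => x.2.2 := by
    change Poly _
    fun_prop
  have hloop : Poly fun a => (a, ([] : List β), (l a).foldl (g a) (s a)) := by
    -- all states have size at most `X + (X + pl) + q + 2`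
    refine ⟨.comp w ci, pi + (Polynomial.X + pl + 1) *
      p.comp (Polynomial.X + (Polynomial.X + pl) + q + 2) + 1, fun a _ => ?_⟩
    obtain ⟨t1, ht1, ht1'⟩ := hi a trivial
    obtain ⟨t2, ht2, ht2'⟩ := hlen a trivial
    have hls := ht2.size_le
    have hll := length_le_size (l a)
    obtain ⟨t3, ht3, ht3'⟩ := hw (l a).length
      ((enc a).size + ((enc a).size + pl.eval (enc a).size) + q.eval (enc a).size + 2) (a, l a, s a)
      (fun j hj => by
        rw [hiter _ _ _ _ hj.le]
        simpa using hj)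
      (by rw [hiter _ _ _ _ le_rfl]; simp)
      (fun j hj => by
        rw [hiter _ _ _ _ hj]
        have h1 := hq a _ (List.take_prefix j (l a))
        have h2 := size_enc_append ((l a).take j) ((l a).drop j)
        rw [List.take_append_drop] at h2
        have h3 := Data.one_le_size (enc ((l a).take j))
        simp only [enc_pair, Data.size]
        omega)
    rw [hiter _ _ _ _ le_rfl] at ht3
    simp only [List.drop_length, List.take_length] at ht3
    refine ⟨_, .comp ht1 ht3, ?_⟩
    have h4 : ((l a).length + 1) ≤ (enc a).size + pl.eval (enc a).size + 1 := by omega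
    have h5 := ht3'.trans (Nat.mul_le_mul_right _ h4)
    simp at h5 ⊢
    omega
  exact Poly.comp (f := fun x : α × List β × γ => x.2.2) hout hloop

/-- The output of a polynomial-time function is polynomially small. -/
theorem Poly.exists_size_le {f : α → β} (hf : Poly f) :
    ∃ q : Polynomial ℕ, ∀ a, (enc (f a)).size ≤ q.eval (enc a).size := by
  obtain ⟨c, p, h⟩ := hf
  refine ⟨Polynomial.X + p, fun a => ?_⟩
  obtain ⟨t, ht, ht'⟩ := h a trivial
  have := ht.size_le
  simp
  omega

@[fun_prop]
theorem Poly.append [Inhabited β] {f g : α → List β} (hf : Poly f) (hg : Poly g) :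
    Poly fun a => f a ++ g a := by
  -- moves the entries of `m` in front of `l`, in reversed order
  have key : ∀ {f g : α → List β}, Poly f → Poly g →
      Poly fun a => (f a).foldl (fun l b => b :: l) (g a) := by
    intro f g hf hg
    obtain ⟨p, hp⟩ := hf.exists_size_le
    obtain ⟨q, hq⟩ := hg.exists_size_le
    refine hf.foldl hg (by fun_prop) (p + q) fun a m hm => ?_
    have h1 : m.foldl (fun l b => b :: l) (g a) = m.reverse ++ g a := by
      simp
    have h2 : ∀ m : List β, (enc m.reverse).size = (enc m).size := by
      intro m
      induction m with
      | nil => rfl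
      | cons b m ih =>
        have := size_enc_append m.reverse [b]
        simp only [List.reverse_cons, enc_cons, enc_nil, Data.size] at this ⊢
        omega
    obtain ⟨m', hm'⟩ := hm
    have h3 := size_enc_append m m'
    have h4 := size_enc_append m.reverse (g a)
    have h5 := hp a
    have h6 := hq a
    have h7 := Data.one_le_size (enc m')
    rw [hm'] at h3
    rw [h1]
    simp only [h2] at h4
    simp
    omega
  have := key (key hf (Poly.const [])) hg
  simpa using this

@[fun_prop]
theorem Poly.flatMap [Inhabited β] [Inhabited γ] {l : α → List β} {f : α → β → List γ}
    (hl : Poly l) (hf : Poly fun x : α × β => f x.1 x.2) : Poly fun a => (l a).flatMap (f a) := by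
  have h0 : ∀ (a : α) (m : List β), m.foldl (fun acc b => acc ++ f a b) [] = m.flatMap (f a) := by
    intro a m
    have : ∀ acc, m.foldl (fun acc b => acc ++ f a b) acc = acc ++ m.flatMap (f a) := by
      induction m with
      | nil => simp
      | cons b m ih => intro acc; simp [ih]
    simpa using this []
  obtain ⟨p, hp⟩ := hl.exists_size_le
  obtain ⟨q, hq⟩ := hf.exists_size_le
  have := hl.foldl (g := fun a acc b => acc ++ f a b) (Poly.const []) (by fun_prop)
    (p * q.comp (Polynomial.X + p + 1) + 1) fun a m hm => by
      rw [h0]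
      have h1 : ∀ m : List β, (∀ b ∈ m, (enc b).size ≤ p.eval (enc a).size) →
          (enc (m.flatMap (f a))).size ≤
            m.length * q.eval ((enc a).size + p.eval (enc a).size + 1) + 1 := by
        intro m hm
        induction m with
        | nil => simp [enc_nil, Data.size]
        | cons b m ih =>
          have h1 := size_enc_append (f a b) (m.flatMap (f a))
          have h2 := ih fun b hb => hm b (by simp [hb])
          have h3 := hq (a, b)
          have h4 := hm b (by simp)
          have h5 : (enc (a, b)).size ≤ (enc a).size + p.eval (enc a).size + 1 := by
            simp only [enc_pair, Data.size]; omega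
          have h6 := eval_mono q h5
          simp only at h3 h6
          simp only [List.flatMap_cons, List.length_cons]
          nlinarith
      have h2 := h1 m fun b hb => (size_le_of_mem (hm.subset hb)).trans (hp a)
      have h3 := (hm.length_le.trans (length_le_size _)).trans (hp a)
      simp
      refine h2.trans ?_
      gcongr
  simpa only [h0] using this

@[fun_prop]
theorem Poly.map [Inhabited β] [Inhabited γ] {l : α → List β} {f : α → β → γ}
    (hl : Poly l) (hf : Poly fun x : α × β => f x.1 x.2) : Poly fun a => (l a).map (f a) := by
  simp only [List.map_eq_flatMap]
  fun_prop

@[fun_prop]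
theorem Poly.filter [Inhabited β] {l : α → List β} {p : α → β → Bool}
    (hl : Poly l) (hp : Poly fun x : α × β => p x.1 x.2) : Poly fun a => (l a).filter (p a) := by
  have : ∀ a, (l a).filter (p a) = (l a).flatMap fun b => bif p a b then [b] else [] := by
    intro a
    induction l a with
    | nil => rfl
    | cons b m ih => cases h : p a b <;> simp [h, ih]
  simp only [this]
  fun_prop

@[fun_prop]
theorem Poly.any [Inhabited β] {l : α → List β} {p : α → β → Bool}
    (hl : Poly l) (hp : Poly fun x : α × β => p x.1 x.2) : Poly fun a => (l a).any (p a) := by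
  have : ∀ a, (l a).any (p a) = !((l a).filter (p a)).isEmpty := by
    intro a
    induction l a with
    | nil => rfl
    | cons b m ih => cases h : p a b <;> simp [h, ih]
  simp only [this]
  fun_prop

@[fun_prop]
theorem Poly.all [Inhabited β] {l : α → List β} {p : α → β → Bool}
    (hl : Poly l) (hp : Poly fun x : α × β => p x.1 x.2) : Poly fun a => (l a).all (p a) := by
  simp only [List.all_eq_not_any_not]
  fun_prop

/-- A natural number is represented like a list of units. -/
@[fun_prop]
theorem Poly.replicate {f : α → ℕ} (hf : Poly f) : Poly fun a => List.replicate (f a) () :=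
  Poly.comp (f := fun n => List.replicate n ()) (.of_enc_eq fun n => by simp [enc]) hf

@[fun_prop]
theorem Poly.length [Inhabited β] {f : α → List β} (hf : Poly f) : Poly fun a => (f a).length := by
  have h : Poly fun l : List Unit => l.length :=
    .of_enc_eq fun l => by simp [enc, List.map_const']
  simpa using h.comp (g := fun a => (f a).map fun _ => ()) (by fun_prop)

@[fun_prop]
theorem Poly.drop [Inhabited β] {n : α → ℕ} {l : α → List β} (hn : Poly n) (hl : Poly l) :
    Poly fun a => (l a).drop (n a) := by
  have h0 : ∀ (m : List Unit) (l : List β), m.foldl (fun l _ => l.tail) l = l.drop m.length := by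
    intro m
    induction m with
    | nil => simp
    | cons _ m ih => intro l; simp [ih]
  obtain ⟨p, hp⟩ := hl.exists_size_le
  have := (hn.replicate).foldl (g := fun _ l _ => l.tail) hl (by fun_prop) p fun a m _ => by
    rw [h0]
    have h1 := size_enc_append ((l a).take m.length) ((l a).drop m.length)
    rw [List.take_append_drop] at h1
    have h2 := Data.one_le_size (enc ((l a).take m.length))
    have h3 := hp a
    omega
  simpa [h0] using this

/-- The entry of `l` at position `i`, or the default value. -/
def entry [Inhabited β] (l : List β) (i : ℕ) : β := (l.drop i).headI

@[fun_prop]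
theorem Poly.entry [Inhabited β] [NilEnc β] {n : α → ℕ} {l : α → List β} (hl : Poly l)
    (hn : Poly n) : Poly fun a => entry (l a) (n a) := by
  unfold LossyCDS.entry
  fun_prop

@[fun_prop]
theorem Poly.nat_le {m n : α → ℕ} (hm : Poly m) (hn : Poly n) :
    Poly fun a => decide (m a ≤ n a) := by
  have : ∀ a, decide (m a ≤ n a) = ((List.replicate (m a) ()).drop (n a)).isEmpty := by
    intro a
    by_cases h : m a ≤ n a
    · simp [h]
    · simp [h]; omega
  simp only [this]
  fun_prop

@[fun_prop]
theorem Poly.nat_beq {m n : α → ℕ} (hm : Poly m) (hn : Poly n) : Poly fun a => m a == n a := by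
  have : ∀ a, (m a == n a) = (decide (m a ≤ n a) && decide (n a ≤ m a)) := by
    intro a
    rw [← Bool.decide_and, Bool.beq_eq_decide_eq]
    simp [le_antisymm_iff]
  simp only [this]
  fun_prop

@[fun_prop]
theorem Poly.bool_beq {f g : α → Bool} (hf : Poly f) (hg : Poly g) : Poly fun a => f a == g a := by
  have : ∀ a, (f a == g a) = bif f a then g a else !(g a) := by
    intro a
    cases f a <;> cases g a <;> rfl
  simp only [this]
  fun_prop

theorem size_enc_nat (n : ℕ) : (enc n).size = 2 * n + 1 := by
  induction n with
  | zero => rfl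
  | succ n ih =>
    have : enc (n + 1) = Data.cons Data.nil (enc n) := rfl
    rw [this]
    simp only [Data.size]
    omega

@[fun_prop]
theorem Poly.range {n : α → ℕ} (hn : Poly n) : Poly fun a => List.range (n a) := by
  have h0 : ∀ m : List Unit, m.foldl (fun l _ => l ++ [l.length]) [] = List.range m.length := by
    intro m
    induction m using List.reverseRecOn with
    | nil => rfl
    | append_singleton m _ ih => simp [ih, List.range_succ]
  obtain ⟨p, hp⟩ := hn.exists_size_le
  have := (hn.replicate).foldl (g := fun _ l _ => l ++ [l.length]) (Poly.const []) (by fun_prop)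
    (p * (p + 1) + 1) fun a m hm => by
      rw [h0]
      have h1 := hm.length_le
      rw [List.length_replicate] at h1
      have h2 := hp a
      rw [size_enc_nat] at h2
      refine (size_enc_le_of_forall (N := p.eval (enc a).size) fun i hi => ?_).trans ?_
      · rw [size_enc_nat]
        simp at hi
        omega
      · simp only [List.length_range, Polynomial.eval_add, Polynomial.eval_mul, Polynomial.eval_one]
        gcongr
        omega
  simpa [h0] using this

/-! ### The reduction and the lifting on matrices and lists -/

/-- Adjacency read off from the matrix `M`. -/
def adj (M : List (List Bool)) (i j : ℕ) : Bool := entry (entry M i) j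

@[fun_prop]
theorem Poly.adj {M : α → List (List Bool)} {i j : α → ℕ} (hM : Poly M) (hi : Poly i)
    (hj : Poly j) : Poly fun a => adj (M a) (i a) (j a) := by
  unfold LossyCDS.adj
  fun_prop

/-- `i` and `j` have the same neighbours in `zl`, and they are equal if one of them is in `zl`. -/
def eqv (M : List (List Bool)) (zl : List ℕ) (i j : ℕ) : Bool :=
  zl.all fun w => (adj M i w == adj M j w) && ((w == i) == (w == j))

@[fun_prop]
theorem Poly.eqv {M : α → List (List Bool)} {zl : α → List ℕ} {i j : α → ℕ} (hM : Poly M)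
    (hz : Poly zl) (hi : Poly i) (hj : Poly j) : Poly fun a => eqv (M a) (zl a) (i a) (j a) := by
  unfold LossyCDS.eqv
  fun_prop

/-- The lists of `s` vertices in which every entry equals or is adjacent to a later one, except for
the last entry. -/
def connLists (M : List (List Bool)) : ℕ → List (List ℕ)
  | 0 => [[]]
  | s + 1 => (List.range M.length).flatMap fun v =>
      ((connLists M s).filter fun l => l.isEmpty || l.any fun u => u == v || adj M v u).map
        fun l => v :: l

@[fun_prop]
theorem Poly.connLists (s : ℕ) {M : α → List (List Bool)} (hM : Poly M) :
    Poly fun a => connLists (M a) s := by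
  refine Poly.comp (f := fun M => LossyCDS.connLists M s) ?_ hM
  induction s with
  | zero => exact Poly.const _
  | succ s ih =>
    unfold LossyCDS.connLists
    fun_prop

/-- The first `s` entries of the two lists are equivalent in pairs. -/
def eqvList (M : List (List Bool)) (zl : List ℕ) : ℕ → List ℕ → List ℕ → Bool
  | 0, _, _ => true
  | s + 1, l, m => eqv M zl l.headI m.headI && eqvList M zl s l.tail m.tail

@[fun_prop]
theorem Poly.eqvList (s : ℕ) {M : α → List (List Bool)} {zl l m : α → List ℕ} (hM : Poly M)
    (hz : Poly zl) (hl : Poly l) (hm : Poly m) :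
    Poly fun a => eqvList (M a) (zl a) s (l a) (m a) := by
  induction s generalizing l m with
  | zero => exact Poly.const _
  | succ s ih =>
    unfold LossyCDS.eqvList
    exact Poly.and (by fun_prop) (ih (by fun_prop) (by fun_prop))

/-- The entries of `l` that are not related to any entry chosen before: if `r` is an equivalence,
one entry from each class that occurs in `l`. -/
def representatives (r : β → β → Bool) (l : List β) : List β :=
  l.foldl (fun acc x => bif acc.any (r x) then acc else x :: acc) []

@[fun_prop]
theorem Poly.representatives [Inhabited β] {r : α → β → β → Bool} {l : α → List β}
    (hr : Poly fun x : α × β × β => r x.1 x.2.1 x.2.2) (hl : Poly l) :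
    Poly fun a => representatives (r a) (l a) := by
  unfold LossyCDS.representatives
  obtain ⟨p, hp⟩ := hl.exists_size_le
  have h1 : Poly fun x : α × β × List β => x.2.2.any fun y => r x.1 x.2.1 y :=
    Poly.any (by fun_prop)
      (hr.comp (g := fun y : (α × β × List β) × β => (y.1.1, y.1.2.1, y.2)) (by fun_prop))
  refine hl.foldl (g := fun a acc x => bif acc.any (r a x) then acc else x :: acc) (Poly.const [])
    (h1.cond (by fun_prop) (by fun_prop)) p fun a m hm => ?_
  have h2 : ∀ (m : List β), (enc (m.foldl
      (fun acc x => bif acc.any (r a x) then acc else x :: acc) [])).size ≤ (enc m).size := by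
    intro m
    induction m using List.reverseRecOn with
    | nil => exact le_rfl
    | append_singleton m x ih =>
      have := size_enc_append m [x]
      simp only [enc_cons, enc_nil, Data.size] at this
      rw [List.foldl_append, List.foldl_cons, List.foldl_nil]
      cases h : List.any _ _
      · simp only [cond_false, enc_cons, Data.size]
        omega
      · simp only [cond_true]
        omega
  obtain ⟨m', hm'⟩ := hm
  have h3 := size_enc_append m m'
  have h4 := Data.one_le_size (enc m')
  rw [hm'] at h3
  have := h2 m
  have := hp a
  omega

/-- For every length from `1` to `t`, one connected list from each class of equivalent ones. -/
def keptLists (M : List (List Bool)) (zl : List ℕ) : ℕ → List (List ℕ)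
  | 0 => []
  | t + 1 => keptLists M zl t ++ representatives (eqvList M zl (t + 1)) (connLists M (t + 1))

@[fun_prop]
theorem Poly.keptLists (t : ℕ) {M : α → List (List Bool)} {zl : α → List ℕ} (hM : Poly M)
    (hz : Poly zl) : Poly fun a => keptLists (M a) (zl a) t := by
  induction t with
  | zero => exact Poly.const _
  | succ t ih =>
    unfold LossyCDS.keptLists
    fun_prop

/-- The vertices in `zl` and in the lists of length at most `t` that are kept. -/
def keptVerts (t : ℕ) (M : List (List Bool)) (zl : List ℕ) : List ℕ :=
  (List.range M.length).filter fun i =>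
    zl.any (fun j => j == i) || (keptLists M zl t).any fun l => l.any fun j => j == i

@[fun_prop]
theorem Poly.keptVerts (t : ℕ) {M : α → List (List Bool)} {zl : α → List ℕ} (hM : Poly M)
    (hz : Poly zl) : Poly fun a => keptVerts t (M a) (zl a) := by
  unfold LossyCDS.keptVerts
  fun_prop

/-- The entries of `xs` that are reached from its first entry by at most `xs.length` steps inside
`xs`. -/
def reached (M : List (List Bool)) (xs : List ℕ) : List ℕ :=
  xs.foldl (fun S _ => xs.filter fun i => S.any fun j => j == i || adj M j i) [xs.headI]

theorem size_enc_filter_le (l : List β) (p : β → Bool) :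
    (enc (l.filter p)).size ≤ (enc l).size := by
  induction l with
  | nil => simp
  | cons b l ih => cases h : p b <;> simp [h, enc_cons, Data.size] <;> omega

@[fun_prop]
theorem Poly.reached {M : α → List (List Bool)} {xs : α → List ℕ} (hM : Poly M)
    (hx : Poly xs) : Poly fun a => reached (M a) (xs a) := by
  unfold LossyCDS.reached
  obtain ⟨p, hp⟩ := hx.exists_size_le
  obtain ⟨q, hq⟩ := Poly.exists_size_le (f := fun a => [(xs a).headI]) (by fun_prop)
  refine hx.foldl (by fun_prop) (by fun_prop) (p + q) fun a m hm => ?_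
  simp only [Polynomial.eval_add]
  induction m using List.reverseRecOn with
  | nil => exact (hq a).trans (by omega)
  | append_singleton m x ih =>
    rw [List.foldl_append, List.foldl_cons]
    exact (size_enc_filter_le _ _).trans ((hp a).trans (by omega))

/-- The graph induced by `xs` is connected (or empty). -/
def connected (M : List (List Bool)) (xs : List ℕ) : Bool :=
  xs.all fun i => (reached M xs).any fun j => j == i

@[fun_prop]
theorem Poly.connected {M : α → List (List Bool)} {xs : α → List ℕ} (hM : Poly M)
    (hx : Poly xs) : Poly fun a => connected (M a) (xs a) := by
  unfold LossyCDS.connected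
  fun_prop

/-- The positions of the entries `true` in the first list of `o`.  Here and below `o` is the output
of the core algorithm, as a list of length at most one. -/
def coreList (M o : List (List Bool)) : List ℕ :=
  (List.range M.length).filter fun i => entry o.headI i

@[fun_prop]
theorem Poly.coreList {M o : α → List (List Bool)} (hM : Poly M)
    (ho : Poly o) : Poly fun a => coreList (M a) (o a) := by
  unfold LossyCDS.coreList
  fun_prop

/-- There is a core, and the vertices kept for it induce a connected graph. -/
def useful (t : ℕ) (M o : List (List Bool)) : Bool :=
  !o.isEmpty && connected M (keptVerts t M (coreList M o))

@[fun_prop]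
theorem Poly.useful (t : ℕ) {M o : α → List (List Bool)} (hM : Poly M)
    (ho : Poly o) : Poly fun a => useful t (M a) (o a) := by
  unfold LossyCDS.useful
  fun_prop

/-- The vertices of the reduced graph: only the first vertex, if any, unless the kept vertices are
useful. -/
def redVerts (t : ℕ) (M o : List (List Bool)) : List ℕ :=
  bif useful t M o then keptVerts t M (coreList M o)
  else (List.range M.length).filter fun i => i == 0

@[fun_prop]
theorem Poly.redVerts (t : ℕ) {M o : α → List (List Bool)} (hM : Poly M)
    (ho : Poly o) : Poly fun a => redVerts t (M a) (o a) := by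
  unfold LossyCDS.redVerts
  fun_prop

/-- The adjacency matrix of the graph induced by `vs`. -/
def subMatrix (M : List (List Bool)) (vs : List ℕ) : List (List Bool) :=
  vs.map fun i => vs.map fun j => adj M i j

@[fun_prop]
theorem Poly.subMatrix {M : α → List (List Bool)} {vs : α → List ℕ} (hM : Poly M)
    (hv : Poly vs) : Poly fun a => subMatrix (M a) (vs a) := by
  unfold LossyCDS.subMatrix
  fun_prop

/-- The lifted solution as a predicate on vertices: the vertices chosen by `S` if `S` is a small
solution of a useful reduced instance, and all vertices otherwise. -/
def lifted (t : ℕ) (M o : List (List Bool)) (k : ℕ) (S : List Bool) (i : ℕ) : Bool :=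
  bif useful t M o && decide ((S.filter fun b => b).length ≤ k) then
    (List.range (redVerts t M o).length).any fun a =>
      entry S a && (entry (redVerts t M o) a == i)
  else true

@[fun_prop]
theorem Poly.lifted (t : ℕ) {M o : α → List (List Bool)} {k i : α → ℕ} {S : α → List Bool}
    (hM : Poly M) (ho : Poly o) (hk : Poly k) (hS : Poly S) (hi : Poly i) :
    Poly fun a => lifted t (M a) (o a) (k a) (S a) (i a) := by
  unfold LossyCDS.lifted
  fun_prop

end Poly

/-! ### Cutting a connected set into small connected pieces -/

section Pieces

variable {V : Type} {G : SimpleGraph V}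

/-- The finite set `S` induces a connected graph. -/
def Conn (G : SimpleGraph V) (S : Finset V) : Prop := (G.induce (S : Set V)).Connected

theorem conn_singleton (v : V) : Conn G {v} := by
  have : Subsingleton ((({v} : Finset V) : Set V)) := by simp
  have : Nonempty ((({v} : Finset V) : Set V)) := by simp
  exact ⟨.of_subsingleton⟩

/-- Every entry of the list, except for the last one, equals or is adjacent to a later entry. -/
def IsConnList (G : SimpleGraph V) : List V → Prop
  | [] => True
  | a :: l => (l = [] ∨ ∃ b ∈ l, b = a ∨ G.Adj a b) ∧ IsConnList G l

theorem IsConnList.append_of_adj {l m : List V} (hl : IsConnList G l)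
    (h : ∀ a ∈ m, ∃ b ∈ l, b = a ∨ G.Adj a b) : IsConnList G (m ++ l) := by
  induction m with
  | nil => exact hl
  | cons a m ih =>
    refine ⟨.inr ?_, ih fun a ha => h a (by simp [ha])⟩
    obtain ⟨b, hb, hab⟩ := h a (by simp)
    exact ⟨b, by simp [hb], hab⟩

theorem IsConnList.append {l m : List V} {u v : V} (hl : IsConnList G l) (hv : v ∈ l)
    (hm : IsConnList G m) (hu : m.getLast? = some u) (h : G.Adj u v) : IsConnList G (m ++ l) := by
  induction m with
  | nil => exact hl
  | cons a m ih =>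
    rcases hm with ⟨rfl | ⟨b, hb, hab⟩, hm⟩
    · obtain rfl : a = u := by simpa using hu
      exact ⟨.inr ⟨v, by simp [hv], .inr h⟩, hl⟩
    · refine ⟨.inr ⟨b, by simp [hb], hab⟩, ih hm ?_⟩
      obtain ⟨c, m, rfl⟩ := List.exists_cons_of_ne_nil (List.ne_nil_of_mem hb)
      simpa [List.getLast?_cons_cons] using hu

variable [DecidableEq V]

theorem Conn.union {S T : Finset V} (hS : Conn G S) (hT : Conn G T) (h : (S ∩ T).Nonempty) :
    Conn G (S ∪ T) := by
  unfold Conn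
  rw [Finset.coe_union]
  exact SimpleGraph.induce_union_connected hS.preconnected hT.preconnected (by exact_mod_cast h)

theorem Conn.insert_adj {S : Finset V} {s x : V} (hS : Conn G S) (hs : s ∈ S) (h : G.Adj s x) :
    Conn G (insert x S) := by
  have := SimpleGraph.connected_induce_union hS.preconnected
    (conn_singleton (G := G) x).preconnected (by exact_mod_cast hs) (by simp) h
  unfold Conn
  rwa [Finset.coe_insert, Set.insert_eq, Set.union_comm, ← Finset.coe_singleton]

theorem Conn.union_of_adj {S Y : Finset V} (hS : Conn G S)
    (h : ∀ x ∈ Y, ∃ s ∈ S, x = s ∨ G.Adj s x) : Conn G (S ∪ Y) := by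
  induction Y using Finset.induction_on with
  | empty => simpa
  | insert x Y _ ih =>
    rw [Finset.union_insert]
    have h1 := ih fun y hy => h y (by simp [hy])
    obtain ⟨s, hs, h2⟩ := h x (by simp)
    by_cases hx : x ∈ S ∪ Y
    · rwa [Finset.insert_eq_of_mem hx]
    · rcases h2 with rfl | h2
      · simp [hs] at hx
      · exact h1.insert_adj (by simp [hs]) h2

theorem IsConnList.conn {l : List V} (hl : IsConnList G l) (h : l ≠ []) : Conn G l.toFinset := by
  induction l with
  | nil => exact absurd rfl h
  | cons a l ih =>
    rcases hl with ⟨rfl | ⟨b, hb, hab⟩, hl⟩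
    · simpa using conn_singleton a
    · have h1 := ih hl (List.ne_nil_of_mem hb)
      rw [List.toFinset_cons]
      rcases hab with rfl | hab
      · rwa [Finset.insert_eq_of_mem (by simpa)]
      · exact h1.insert_adj (by simpa using hb) hab.symm

/-- `D` is the vertex set of a tree in `G` with root `v`, built by hanging the root of one tree to
the root of another. -/
inductive HasRootedTree (G : SimpleGraph V) : Finset V → V → Prop
  | single (v : V) : HasRootedTree G {v} v
  | join {A B : Finset V} {v u : V} : HasRootedTree G A v → HasRootedTree G B u → Disjoint A B →
      G.Adj v u → HasRootedTree G (A ∪ B) v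

theorem HasRootedTree.root_mem {D : Finset V} {v : V} (h : HasRootedTree G D v) : v ∈ D := by
  induction h with
  | single => simp
  | join _ _ _ _ ih => simp [ih]

theorem HasRootedTree.insert_leaf {D : Finset V} {v u w : V} (h : HasRootedTree G D v) (hu : u ∈ D)
    (hw : w ∉ D) (huw : G.Adj u w) : HasRootedTree G (insert w D) v := by
  induction h with
  | single v =>
    obtain rfl : u = v := by simpa using hu
    rw [Finset.insert_eq, Finset.union_comm]
    exact .join (.single _) (.single _) (by simpa using huw.ne) huw
  | @join A B v x hA hB hd hvx ihA ihB =>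
    simp only [Finset.mem_union, not_or] at hu hw
    rcases hu with hu | hu
    · rw [← Finset.insert_union]
      exact .join (ihA hu hw.1) hB (by simp [hd, hw.2]) hvx
    · rw [← Finset.union_insert]
      exact .join hA (ihB hu hw.2) (by simp [hd, hw.1]) hvx

theorem Conn.hasRootedTree {D : Finset V} (hD : Conn G D) {v : V} (hv : v ∈ D) :
    HasRootedTree G D v := by
  classical
  -- a largest subset with a tree
  obtain ⟨S, hS, hmax⟩ := (D.powerset.filter fun S => HasRootedTree G S v).exists_max_image
    Finset.card ⟨{v}, by simpa [hv] using HasRootedTree.single v⟩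
  simp only [Finset.mem_filter, Finset.mem_powerset] at hS hmax
  obtain rfl | hne := eq_or_ne S D
  · exact hS.2
  obtain ⟨x, hxD, hxS⟩ := Finset.exists_of_ssubset (Finset.ssubset_iff_subset_ne.2 ⟨hS.1, hne⟩)
  obtain ⟨p⟩ := hD.preconnected ⟨v, hv⟩ ⟨x, hxD⟩
  obtain ⟨d, -, hd1, hd2⟩ := p.exists_boundary_dart {y | y.1 ∈ S} hS.2.root_mem hxS
  have h1 := hS.2.insert_leaf hd1 hd2 d.adj
  have h2 := hmax _ ⟨Finset.insert_subset d.snd.2 hS.1, h1⟩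
  rw [Finset.card_insert_of_notMem hd2] at h2
  omega

variable {X : Finset V} {E : V → V → Prop} {α ζ : V → V} {t : ℕ}

/-- A connected piece together with the anchors of some of its vertices is replaced by a connected
set of equivalent vertices from `X`, which also contains the connectors of those vertices. -/
theorem exists_replacement
    (hX : ∀ l, IsConnList G l → l.length ≤ 4 * t →
      ∃ l', IsConnList G l' ∧ (∀ x ∈ l', x ∈ X) ∧ List.Forall₂ E l l')
    {D : Finset V} (hα : ∀ b ∈ D, α b = b ∨ G.Adj (α b) b) (hζ : ∀ b ∈ D, ζ b ∈ X)
    (hαζ : ∀ b ∈ D, ∀ v, E (α b) v → ζ b = v ∨ G.Adj v (ζ b))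
    {l : List V} (hl : IsConnList G l) (hne : l ≠ []) (hlD : ∀ x ∈ l, x ∈ D)
    (hlt : l.length ≤ 2 * t)
    {B : Finset V} (hB : B ⊆ l.toFinset) :
    ∃ P : Finset V, P ⊆ X ∧ P.card ≤ l.length + 2 * B.card ∧ Conn G P ∧
      (∀ u ∈ l, ∃ u' ∈ P, E u u') ∧ ∀ b ∈ B, ζ b ∈ P := by
  have hBl : ∀ b ∈ B, b ∈ l := fun b hb => by simpa using hB hb
  have hcard : B.card ≤ l.length := (Finset.card_le_card hB).trans l.toFinset_card_le
  have h1 : IsConnList G (B.toList.map α ++ l) := hl.append_of_adj fun a ha => by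
    simp only [List.mem_map, Finset.mem_toList] at ha
    obtain ⟨b, hb, rfl⟩ := ha
    exact ⟨b, hBl b hb, (hα b (hlD b (hBl b hb))).imp Eq.symm fun h => h⟩
  obtain ⟨l', hl', hX', hE⟩ := hX _ h1 (by simp; omega)
  have hrep : ∀ u ∈ B.toList.map α ++ l, ∃ u' ∈ l', E u u' := by
    intro u hu
    obtain ⟨i, hi, rfl⟩ := List.getElem_of_mem hu
    have := List.forall₂_iff_get.1 hE
    exact ⟨l'[i]'(this.1 ▸ hi), List.getElem_mem _, this.2 i hi (this.1 ▸ hi)⟩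
  have hlen : l'.length = B.card + l.length := by
    rw [← hE.length_eq]; simp
  have hne' : l' ≠ [] := by
    rintro rfl
    have := List.length_pos_of_ne_nil hne
    simp at hlen
    omega
  refine ⟨l'.toFinset ∪ B.image ζ, ?_, ?_, ?_, ?_, ?_⟩
  · intro x hx
    simp only [Finset.mem_union, List.mem_toFinset, Finset.mem_image] at hx
    rcases hx with hx | ⟨b, hb, rfl⟩
    · exact hX' x hx
    · exact hζ b (hlD b (hBl b hb))
  · have h2 := Finset.card_union_le l'.toFinset (B.image ζ)
    have h3 := l'.toFinset_card_le
    have h4 : (B.image ζ).card ≤ B.card := Finset.card_image_le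
    omega
  · refine (hl'.conn hne').union_of_adj fun x hx => ?_
    obtain ⟨b, hb, rfl⟩ := Finset.mem_image.1 hx
    obtain ⟨v, hv, hbv⟩ := hrep (α b) (by simp; exact .inl ⟨b, hb, rfl⟩)
    exact ⟨v, by simpa using hv, hαζ b (hlD b (hBl b hb)) v hbv⟩
  · intro u hu
    obtain ⟨u', hu', h⟩ := hrep u (by simp [hu])
    exact ⟨u', by simp [hu'], h⟩
  · intro b hb
    simp only [Finset.mem_union, Finset.mem_image]
    exact .inr ⟨b, hb, rfl⟩

/-- The pieces are cut off from the leaves towards the root `v` as soon as they have more than `t`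
vertices.  The list `l` is the part of `D` that is left over, `F` collects the replacements of the
`m` pieces that were cut off, and `B` consists of the vertices of `l` that were the roots of
pieces.  Whatever replaces `l` will be connected to `F` if it contains the connectors of `B`. -/
theorem HasRootedTree.exists_pieces
    (hX : ∀ l, IsConnList G l → l.length ≤ 4 * t →
      ∃ l', IsConnList G l' ∧ (∀ x ∈ l', x ∈ X) ∧ List.Forall₂ E l l')
    {D : Finset V} (hα : ∀ b ∈ D, α b = b ∨ G.Adj (α b) b) (hζ : ∀ b ∈ D, ζ b ∈ X)
    (hαζ : ∀ b ∈ D, ∀ v, E (α b) v → ζ b = v ∨ G.Adj v (ζ b)) (ht : 1 ≤ t)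
    {v : V} (h : HasRootedTree G D v) :
    ∃ (l : List V) (B F : Finset V) (m : ℕ), IsConnList G l ∧ l.getLast? = some v ∧
      (∀ x ∈ l, x ∈ D) ∧ l.length ≤ t ∧ B ⊆ l.toFinset ∧ m * t + l.length ≤ D.card ∧
      F.card + l.length + 2 * B.card ≤ D.card + 5 * m ∧ F ⊆ X ∧
      (∀ u ∈ D, u ∈ l ∨ ∃ u' ∈ F, E u u') ∧
      ∀ C, Conn G C → (∀ b ∈ B, ζ b ∈ C) → Conn G (C ∪ F) := by
  induction h with
  | single v =>
    refine ⟨[v], ∅, ∅, 0, ⟨.inl rfl, trivial⟩, rfl, by simp, by simpa, by simp, by simp, by simp,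
      by simp, by simp, by simp⟩
  | @join A B v u hA hB hd hvu ihA ihB =>
    obtain ⟨lA, BA, FA, mA, cA, rA, dA, tA, sA, nA, wA, xA, eA, kA⟩ := ihA
      (fun b hb => hα b (by simp [hb])) (fun b hb => hζ b (by simp [hb]))
      (fun b hb => hαζ b (by simp [hb]))
    obtain ⟨lB, BB, FB, mB, cB, rB, dB, tB, sB, nB, wB, xB, eB, kB⟩ := ihB
      (fun b hb => hα b (by simp [hb])) (fun b hb => hζ b (by simp [hb]))
      (fun b hb => hαζ b (by simp [hb]))
    have hvA : v ∈ lA := List.mem_of_getLast? rA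
    have hc : IsConnList G (lB ++ lA) := cA.append hvA cB rB hvu.symm
    have hlast : (lB ++ lA).getLast? = some v := by
      rw [List.getLast?_append, rA]; rfl
    have hsub : ∀ x ∈ lB ++ lA, x ∈ A ∪ B := by
      intro x hx
      rcases List.mem_append.1 hx with hx | hx
      · simp [dB x hx]
      · simp [dA x hx]
    have hcard : (A ∪ B).card = A.card + B.card := Finset.card_union_of_disjoint hd
    have hBs : BA ∪ BB ⊆ (lB ++ lA).toFinset := by
      rw [List.toFinset_append, Finset.union_comm]
      exact Finset.union_subset_union sB sA
    have hBcard := Finset.card_union_le BA BB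
    have hFcard := Finset.card_union_le FA FB
    have hcover : ∀ x ∈ A ∪ B, x ∈ lB ++ lA ∨ ∃ x' ∈ FA ∪ FB, E x x' := by
      intro x hx
      rcases Finset.mem_union.1 hx with hx | hx
      · rcases eA x hx with h | ⟨x', h, h'⟩
        · simp [h]
        · exact .inr ⟨x', by simp [h], h'⟩
      · rcases eB x hx with h | ⟨x', h, h'⟩
        · simp [h]
        · exact .inr ⟨x', by simp [h], h'⟩
    have hconn : ∀ C, Conn G C → (∀ b ∈ BA ∪ BB, ζ b ∈ C) → Conn G (C ∪ (FA ∪ FB)) := by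
      intro C hC hb
      rw [← Finset.union_assoc]
      refine kB _ (kA C hC fun b h => hb b (by simp [h])) fun b h => ?_
      exact Finset.mem_union_left _ (hb b (by simp [h]))
    by_cases hlen : (lB ++ lA).length ≤ t
    · refine ⟨lB ++ lA, BA ∪ BB, FA ∪ FB, mA + mB, hc, hlast, hsub, hlen, hBs, ?_, ?_,
        Finset.union_subset xA xB, hcover, hconn⟩
      · rw [hcard, List.length_append]
        nlinarith
      · rw [hcard, List.length_append]
        omega
    · have hB' : insert v (BA ∪ BB) ⊆ (lB ++ lA).toFinset :=
        Finset.insert_subset (List.mem_toFinset.2 (List.mem_append_right _ hvA)) hBs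
      obtain ⟨P, hPX, hPc, hP, hPe, hPζ⟩ := exists_replacement hX hα hζ hαζ hc
        (by rintro h; simp [h] at hlast) hsub (by rw [List.length_append]; omega) hB'
      have hins := Finset.card_insert_le v (BA ∪ BB)
      have hPF := Finset.card_union_le P (FA ∪ FB)
      rw [List.length_append] at hlen hPc
      refine ⟨[v], {v}, P ∪ (FA ∪ FB), mA + mB + 1, ⟨.inl rfl, trivial⟩, rfl, ?_, by simpa, by simp,
        ?_, ?_, Finset.union_subset hPX (Finset.union_subset xA xB), ?_, ?_⟩
      · simp [hA.root_mem]
      · rw [hcard, List.length_singleton]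
        nlinarith
      · rw [hcard, List.length_singleton, Finset.card_singleton]
        omega
      · intro x hx
        right
        rcases hcover x hx with h | ⟨x', h, h'⟩
        · obtain ⟨x', h, h'⟩ := hPe x h
          exact ⟨x', by simp [h], h'⟩
        · exact ⟨x', Finset.mem_union_right _ h, h'⟩
      · intro C hC hb
        rw [← Finset.union_assoc]
        have hζv : ζ v ∈ C := hb v (by simp)
        refine hconn _ (hC.union hP ⟨ζ v, ?_⟩) fun b hb => ?_
        · exact Finset.mem_inter.2 ⟨hζv, hPζ v (by simp)⟩
        · exact Finset.mem_union_right _ (hPζ b (Finset.mem_insert_of_mem hb))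

/-- A connected set is imitated inside `X` at the cost of five vertices for every `t` vertices. -/
theorem Conn.exists_imitation
    (hX : ∀ l, IsConnList G l → l.length ≤ 4 * t →
      ∃ l', IsConnList G l' ∧ (∀ x ∈ l', x ∈ X) ∧ List.Forall₂ E l l')
    {D : Finset V} (hα : ∀ b ∈ D, α b = b ∨ G.Adj (α b) b) (hζ : ∀ b ∈ D, ζ b ∈ X)
    (hαζ : ∀ b ∈ D, ∀ v, E (α b) v → ζ b = v ∨ G.Adj v (ζ b)) (ht : 1 ≤ t) (hD : Conn G D) :
    ∃ (D' : Finset V) (m : ℕ), D' ⊆ X ∧ Conn G D' ∧ m * t ≤ D.card ∧ D'.card ≤ D.card + 5 * m ∧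
      ∀ u ∈ D, ∃ u' ∈ D', E u u' := by
  obtain ⟨⟨v, hv⟩⟩ := hD.nonempty
  obtain ⟨l, B, F, m, hc, hr, hs, hlt, hB, hm, hw, hF, he, hk⟩ :=
    (hD.hasRootedTree (v := v) hv).exists_pieces hX hα hζ hαζ ht
  obtain ⟨P, hPX, hPc, hP, hPe, hPζ⟩ := exists_replacement hX hα hζ hαζ hc
    (by rintro h; simp [h] at hr) hs (by omega) hB
  refine ⟨P ∪ F, m, Finset.union_subset hPX hF, hk P hP hPζ, by omega, ?_, fun u hu => ?_⟩
  · have := Finset.card_union_le P F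
    omega
  · rcases he u hu with h | ⟨x', h, h'⟩
    · obtain ⟨x', h, h'⟩ := hPe u h
      exact ⟨x', by simp [h], h'⟩
    · exact ⟨x', by simp [h], h'⟩

/-- `u` and `v` have the same neighbours in `Z`, and they are equal if one of them is in `Z`. -/
def Twins (G : SimpleGraph V) (Z : Finset V) (u v : V) : Prop :=
  ∀ w ∈ Z, (G.Adj u w ↔ G.Adj v w) ∧ (w = u ↔ w = v)

/-- If `X` contains the core `Z` and imitates connected lists up to length `4 * t`, then it contains
a connected dominating set that is larger than `D` by a factor of at most `1 + 5 / t`. -/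
theorem exists_isCDS_subset [Fintype V] {Z D : Finset V} {k : ℕ} (hZ : IsDomCore G k Z)
    (hZX : Z ⊆ X)
    (hX : ∀ l, IsConnList G l → l.length ≤ 4 * t →
      ∃ l', IsConnList G l' ∧ (∀ x ∈ l', x ∈ X) ∧ List.Forall₂ (Twins G Z) l l')
    (ht : 1 ≤ t) (hD : IsCDS G D) (hDk : D.card ≤ k) :
    ∃ (D' : Finset V) (m : ℕ), D' ⊆ X ∧ IsCDS G D' ∧ m * t ≤ D.card ∧
      D'.card ≤ D.card + 5 * m := by
  classical
  -- the vertices of `D` that matter for `Z` dominate `Z`, hence the whole graph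
  have h0 : Dominates G (D.filter fun u => ∃ z ∈ Z, z = u ∨ G.Adj u z) Finset.univ := by
    refine hZ _ ((Finset.card_filter_le _ _).trans hDk) fun z hz => ?_
    rcases hD.2 z (Finset.mem_univ _) with h | ⟨u, hu, huz⟩
    · exact .inl (by simpa using ⟨h, z, hz, .inl rfl⟩)
    · exact .inr ⟨u, by simpa using ⟨hu, z, hz, .inr huz⟩, huz⟩
  have h1 : ∀ b : V, ∃ a ζ : V, (a = b ∨ G.Adj a b) ∧ ζ ∈ Z ∧ (ζ = a ∨ G.Adj a ζ) := by
    intro b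
    rcases h0 b (Finset.mem_univ _) with h | ⟨u, hu, hub⟩
    · obtain ⟨-, z, hz, h⟩ := Finset.mem_filter.1 h
      exact ⟨b, z, .inl rfl, hz, h⟩
    · obtain ⟨-, z, hz, h⟩ := Finset.mem_filter.1 hu
      exact ⟨u, z, .inr hub, hz, h⟩
  choose α ζ hα hζ hαζ using h1
  obtain ⟨D', m, hX', hc, hm, hcard, he⟩ := Conn.exists_imitation (α := α) (ζ := ζ) hX
    (fun b _ => hα b) (fun b _ => hZX (hζ b)) (fun b _ v hv => by
      have := hv (ζ b) (hζ b)
      rw [← this.1, ← this.2]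
      exact hαζ b) ht hD.1
  refine ⟨D', m, hX', ⟨hc, ?_⟩, hm, hcard⟩
  choose! r hr hrE using he
  -- one twin for each vertex of `D` suffices, so that the core property applies
  have h2 : Dominates G (D.image r) Finset.univ := by
    refine hZ _ (Finset.card_image_le.trans hDk) fun z hz => ?_
    rcases hD.2 z (Finset.mem_univ _) with h | ⟨u, hu, huz⟩
    · left
      have := ((hrE z h) z hz).2.1 rfl
      rw [this]
      exact Finset.mem_image_of_mem r h
    · right
      exact ⟨r u, Finset.mem_image_of_mem r hu, ((hrE u hu) z hz).1.1 huz⟩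
  have h3 : D.image r ⊆ D' := Finset.image_subset_iff.2 hr
  intro x hx
  rcases h2 x hx with h | ⟨u, hu, hux⟩
  · exact .inl (h3 h)
  · exact .inr ⟨u, h3 hu, hux⟩

end Pieces

/-! ### The programs compute what they should -/

section Representatives

variable {β : Type} {r : β → β → Bool}

theorem representatives_append (l : List β) (x : β) :
    representatives r (l ++ [x]) =
      bif (representatives r l).any (r x) then representatives r l
      else x :: representatives r l := by
  simp [representatives]

theorem representatives_subset (l : List β) : representatives r l ⊆ l := by
  induction l using List.reverseRecOn with
  | nil => simp [representatives]
  | append_singleton l x ih =>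
    rw [representatives_append]
    cases (representatives r l).any (r x) <;> intro y hy <;> simp at hy ⊢
    · rcases hy with rfl | hy
      · exact .inr rfl
      · exact .inl (ih hy)
    · exact .inl (ih hy)

theorem exists_mem_representatives {l : List β} (hr : ∀ x ∈ l, r x x = true) :
    ∀ x ∈ l, ∃ y ∈ representatives r l, r x y = true := by
  induction l using List.reverseRecOn with
  | nil => simp
  | append_singleton l x ih =>
    rw [representatives_append]
    intro y hy
    have ih := ih fun x hx => hr x (by simp [hx])
    cases h : (representatives r l).any (r x)
    · rcases List.mem_append.1 hy with hy | hy
      · obtain ⟨z, hz, h⟩ := ih y hy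
        exact ⟨z, by simp [hz], h⟩
      · obtain rfl : y = x := by simpa using hy
        exact ⟨y, by simp, hr y (by simp)⟩
    · rcases List.mem_append.1 hy with hy | hy
      · exact ih y hy
      · obtain rfl : y = x := by simpa using hy
        simpa using h

theorem pairwise_representatives (l : List β) :
    (representatives r l).Pairwise fun x y => r x y = false := by
  induction l using List.reverseRecOn with
  | nil => simp [representatives]
  | append_singleton l x ih =>
    rw [representatives_append]
    cases h : (representatives r l).any (r x)
    · simpa [ih] using h
    · exact ih

end Representatives

section Correctness

variable {n : ℕ} {G : SimpleGraph (Fin n)} {M : List (List Bool)} {zl : List ℕ}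
  {Z : Finset (Fin n)}

theorem eqv_iff (hM : ∀ i j : Fin n, adj M i j = true ↔ G.Adj i j)
    (hz : ∀ i : ℕ, i ∈ zl ↔ ∃ h : i < n, ⟨i, h⟩ ∈ Z) (i j : Fin n) :
    eqv M zl i j = true ↔ Twins G Z i j := by
  simp only [eqv, List.all_eq_true, Bool.and_eq_true, beq_iff_eq, Twins]
  constructor
  · intro h w hw
    obtain ⟨h1, h2⟩ := h w ((hz w).2 ⟨w.2, hw⟩)
    rw [← hM, ← hM, h1]
    refine ⟨Iff.rfl, ?_⟩
    rw [Bool.eq_iff_iff] at h2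
    simpa [Fin.ext_iff] using h2
  · intro h w hw
    obtain ⟨hn, hw⟩ := (hz w).1 hw
    obtain ⟨h1, h2⟩ := h _ hw
    rw [← hM, ← hM, ← Bool.eq_iff_iff] at h1
    refine ⟨h1, ?_⟩
    rw [Bool.eq_iff_iff]
    simpa [Fin.ext_iff] using h2

theorem mem_connLists (hl : M.length = n) (hM : ∀ i j : Fin n, adj M i j = true ↔ G.Adj i j)
    {s : ℕ} {l : List ℕ} :
    l ∈ connLists M s ↔
      ∃ l' : List (Fin n), l'.map Fin.val = l ∧ l'.length = s ∧ IsConnList G l' := by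
  induction s generalizing l with
  | zero =>
    simp only [connLists, List.mem_singleton, List.length_eq_zero_iff]
    constructor
    · rintro rfl
      exact ⟨[], rfl, rfl, trivial⟩
    · rintro ⟨_, rfl, rfl, -⟩
      rfl
  | succ s ih =>
    simp only [connLists, List.mem_flatMap, List.mem_range, List.mem_map, List.mem_filter, hl]
    constructor
    · rintro ⟨v, hv, m, ⟨hm, hnear⟩, rfl⟩
      obtain ⟨m, rfl, hlen, hm⟩ := ih.1 hm
      refine ⟨⟨v, hv⟩ :: m, by simp, by simp [hlen], ?_, hm⟩
      simp only [Bool.or_eq_true, List.isEmpty_iff, List.map_eq_nil_iff, List.any_eq_true,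
        List.mem_map, beq_iff_eq] at hnear
      refine hnear.imp_right ?_
      rintro ⟨_, ⟨u, hu, rfl⟩, h⟩
      exact ⟨u, hu, h.imp (fun h => Fin.ext h) (hM ⟨v, hv⟩ u).1⟩
    · rintro ⟨_ | ⟨v, m⟩, rfl, hlen, hc⟩
      · simp at hlen
      · refine ⟨v, v.2, m.map Fin.val, ⟨ih.2 ⟨m, rfl, by simpa using hlen, hc.2⟩, ?_⟩, rfl⟩
        simp only [Bool.or_eq_true, List.isEmpty_iff, List.map_eq_nil_iff, List.any_eq_true,
          List.mem_map, beq_iff_eq]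
        refine hc.1.imp_right ?_
        rintro ⟨u, hu, h⟩
        exact ⟨u, ⟨u, hu, rfl⟩, h.imp (fun h => congrArg _ h) (hM v u).2⟩

theorem eqvList_iff (hM : ∀ i j : Fin n, adj M i j = true ↔ G.Adj i j)
    (hz : ∀ i : ℕ, i ∈ zl ↔ ∃ h : i < n, ⟨i, h⟩ ∈ Z) {s : ℕ} {l m : List (Fin n)}
    (hl : l.length = s) (hm : m.length = s) :
    eqvList M zl s (l.map Fin.val) (m.map Fin.val) = true ↔ List.Forall₂ (Twins G Z) l m := by
  induction s generalizing l m with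
  | zero =>
    rw [List.length_eq_zero_iff] at hl hm
    simp [hl, hm, eqvList]
  | succ s ih =>
    obtain ⟨a, l, rfl⟩ := List.exists_cons_of_length_eq_add_one hl
    obtain ⟨b, m, rfl⟩ := List.exists_cons_of_length_eq_add_one hm
    simp only [eqvList, List.map_cons, List.headI, List.tail_cons, Bool.and_eq_true,
      List.forall₂_cons]
    rw [eqv_iff hM hz, ih (by simpa using hl) (by simpa using hm)]

theorem twins_refl (u : Fin n) : Twins G Z u u := fun _ _ => ⟨Iff.rfl, Iff.rfl⟩

theorem mem_keptLists {t : ℕ} {l : List ℕ} :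
    l ∈ keptLists M zl t ↔
      ∃ s, 1 ≤ s ∧ s ≤ t ∧ l ∈ representatives (eqvList M zl s) (connLists M s) := by
  induction t with
  | zero =>
    simp only [keptLists, List.not_mem_nil, false_iff]
    rintro ⟨s, h1, h2, -⟩
    omega
  | succ t ih =>
    rw [keptLists, List.mem_append, ih]
    constructor
    · rintro (⟨s, h1, h2, h⟩ | h)
      · exact ⟨s, h1, by omega, h⟩
      · exact ⟨t + 1, by omega, le_rfl, h⟩
    · rintro ⟨s, h1, h2, h⟩
      rcases h2.eq_or_lt with rfl | h2
      · exact .inr h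
      · exact .inl ⟨s, h1, by omega, h⟩

/-- Every short connected list has a twin among the lists that are kept. -/
theorem exists_keptLists (hl : M.length = n) (hM : ∀ i j : Fin n, adj M i j = true ↔ G.Adj i j)
    (hz : ∀ i : ℕ, i ∈ zl ↔ ∃ h : i < n, ⟨i, h⟩ ∈ Z) {t : ℕ} {l : List (Fin n)}
    (hc : IsConnList G l) (hne : l ≠ []) (hlen : l.length ≤ t) :
    ∃ l' : List (Fin n), IsConnList G l' ∧ l'.map Fin.val ∈ keptLists M zl t ∧
      List.Forall₂ (Twins G Z) l l' := by
  obtain ⟨m, hm, hlm⟩ := exists_mem_representatives (r := eqvList M zl l.length)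
    (l := connLists M l.length) (fun x hx => by
      obtain ⟨m, rfl, hm, -⟩ := (mem_connLists hl hM).1 hx
      rw [eqvList_iff hM hz hm hm]
      exact List.forall₂_same.2 fun u _ => twins_refl u)
    (l.map Fin.val) ((mem_connLists hl hM).2 ⟨l, rfl, rfl, hc⟩)
  obtain ⟨m, rfl, hm', hcm⟩ := (mem_connLists hl hM).1 (representatives_subset _ hm)
  refine ⟨m, hcm, mem_keptLists.2 ⟨l.length, List.length_pos_of_ne_nil hne, hlen, hm⟩, ?_⟩
  exact (eqvList_iff hM hz rfl hm').1 hlm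

/-- There is a map to a set of `|Z| + index(∼_Z)` elements that separates vertices which are
no twins. -/
theorem exists_classes (G : SimpleGraph (Fin n)) (Z : Finset (Fin n)) :
    ∃ (C : Type) (_ : Fintype C) (κ : Fin n → C),
      Fintype.card C = Z.card + Nat.card (Quotient (simZ G Z)) ∧
      ∀ u v, κ u = κ v → Twins G Z u v := by
  classical
  have : Fintype (Quotient (simZ G Z)) := Fintype.ofFinite _
  refine ⟨Z ⊕ Quotient (simZ G Z), inferInstance,
    fun v => if h : v ∈ Z then .inl ⟨v, h⟩ else .inr (Quotient.mk _ ⟨v, h⟩), ?_, ?_⟩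
  · simp [Nat.card_eq_fintype_card]
  · intro u v h
    by_cases hu : u ∈ Z <;> by_cases hv : v ∈ Z
    · obtain rfl : u = v := by simpa [hu, hv] using h
      exact twins_refl u
    · simp [hu, hv] at h
    · simp [hu, hv] at h
    · simp only [hu, hv, dif_neg, not_false_iff, Sum.inr.injEq] at h
      have h := Quotient.exact h
      change G.neighborSet u ∩ (Z : Set (Fin n)) = G.neighborSet v ∩ (Z : Set (Fin n)) at h
      intro w hw
      have := Set.ext_iff.1 h w
      refine ⟨by simpa [hw] using this, ⟨?_, ?_⟩⟩
      · rintro rfl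
        exact absurd hw hu
      · rintro rfl
        exact absurd hw hv

/-- Lists of length `s` that are no twins of each other differ in the sequences of the classes of
their entries.  The sequences are read with `[·]?`, whence the additional class. -/
theorem length_representatives_le (hl : M.length = n)
    (hM : ∀ i j : Fin n, adj M i j = true ↔ G.Adj i j)
    (hz : ∀ i : ℕ, i ∈ zl ↔ ∃ h : i < n, ⟨i, h⟩ ∈ Z) (s : ℕ) :
    (representatives (eqvList M zl s) (connLists M s)).length ≤
      (Z.card + Nat.card (Quotient (simZ G Z)) + 1) ^ s := by
  obtain ⟨C, _, κ, hC, hκ⟩ := exists_classes G Z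
  set R := representatives (eqvList M zl s) (connLists M s) with hR
  have hmem : ∀ l ∈ R, ∃ l' : List (Fin n), l'.map Fin.val = l ∧ l'.length = s := fun l h => by
    obtain ⟨l', h1, h2, -⟩ := (mem_connLists hl hM).1 (representatives_subset _ h)
    exact ⟨l', h1, h2⟩
  choose! f hf hlen using hmem
  -- the classes of the entries determine a list in `R`
  have hnodup : (R.map fun l => fun i : Fin s => ((f l).map κ)[(i : ℕ)]?).Nodup := by
    rw [List.Nodup, List.pairwise_map]
    refine (pairwise_representatives _).imp_of_mem fun {l m} hlR hmR h heq => ?_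
    rw [← hf l hlR, ← hf m hmR] at h
    refine Bool.false_ne_true (h.symm.trans ?_)
    rw [eqvList_iff hM hz (hlen l hlR) (hlen m hmR)]
    refine List.forall₂_iff_get.2 ⟨by rw [hlen l hlR, hlen m hmR], fun i h1 h2 => hκ _ _ ?_⟩
    have := congrFun heq ⟨i, hlen l hlR ▸ h1⟩
    simpa [h1, h2] using this
  have := hnodup.length_le_card
  simpa [hC] using this

theorem length_keptLists_le (hl : M.length = n)
    (hM : ∀ i j : Fin n, adj M i j = true ↔ G.Adj i j)
    (hz : ∀ i : ℕ, i ∈ zl ↔ ∃ h : i < n, ⟨i, h⟩ ∈ Z) (t : ℕ) :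
    (keptLists M zl t).length ≤ t * (Z.card + Nat.card (Quotient (simZ G Z)) + 1) ^ t := by
  induction t with
  | zero => simp [keptLists]
  | succ t ih =>
    rw [keptLists, List.length_append, add_mul, one_mul]
    refine add_le_add (ih.trans ?_) (length_representatives_le hl hM hz (t + 1))
    gcongr <;> omega

theorem length_keptVerts_le (hl : M.length = n)
    (hM : ∀ i j : Fin n, adj M i j = true ↔ G.Adj i j)
    (hz : ∀ i : ℕ, i ∈ zl ↔ ∃ h : i < n, ⟨i, h⟩ ∈ Z) (t : ℕ) :
    (keptVerts t M zl).length ≤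
      Z.card + t * (t * (Z.card + Nat.card (Quotient (simZ G Z)) + 1) ^ t) := by
  have h1 : (keptVerts t M zl).Nodup := List.nodup_range.filter _
  have h2 : (keptVerts t M zl) ⊆
      (Z.toList.map Fin.val) ++ (keptLists M zl t).flatten := by
    intro i hi
    simp only [keptVerts, List.mem_filter, Bool.or_eq_true, List.any_eq_true, beq_iff_eq,
      exists_eq_right] at hi
    rw [List.mem_append]
    refine hi.2.imp (fun h => ?_) fun h => List.mem_flatten.2 h
    obtain ⟨h, hZ⟩ := (hz i).1 h
    exact List.mem_map.2 ⟨⟨i, h⟩, by simpa using hZ, rfl⟩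
  have h3 := (List.subperm_of_subset h1 h2).length_le
  have h4 : (keptLists M zl t).flatten.length ≤ (keptLists M zl t).length * t := by
    rw [List.length_flatten]
    refine (List.sum_le_card_nsmul _ t ?_).trans (by simp)
    intro x hx
    obtain ⟨l, hlk, rfl⟩ := List.mem_map.1 hx
    obtain ⟨s, -, hs, h⟩ := mem_keptLists.1 hlk
    obtain ⟨l', rfl, h', -⟩ := (mem_connLists hl hM).1 (representatives_subset _ h)
    simpa [h'] using hs
  have h5 := Nat.mul_le_mul_right t (length_keptLists_le hl hM hz t)
  rw [List.length_append, List.length_map, Finset.length_toList] at h3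
  rw [mul_comm t]
  omega

theorem mem_coreList (hl : M.length = n) {o : List (List Bool)}
    (ho : ∀ i : Fin n, entry o.headI i = true ↔ i ∈ Z) (i : ℕ) :
    i ∈ coreList M o ↔ ∃ h : i < n, ⟨i, h⟩ ∈ Z := by
  simp only [coreList, List.mem_filter, List.mem_range, hl]
  constructor
  · rintro ⟨h, h'⟩
    exact ⟨h, (ho ⟨i, h⟩).1 h'⟩
  · rintro ⟨h, h'⟩
    exact ⟨h, (ho ⟨i, h⟩).2 h'⟩

/-- The connectivity test is correct: a path inside `X` has fewer than `|X|` edges. -/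
theorem connected_iff (hM : ∀ i j : Fin n, adj M i j = true ↔ G.Adj i j) {xs : List ℕ}
    {X : Finset (Fin n)} (hX : ∀ i : ℕ, i ∈ xs ↔ ∃ h : i < n, ⟨i, h⟩ ∈ X) (hne : X.Nonempty) :
    connected M xs = true ↔ Conn G X := by
  have hr : reached M xs =
      (fun S => xs.filter fun i => S.any fun j => j == i || adj M j i)^[xs.length] [xs.headI] := by
    rw [reached, List.foldl_const]
  set step : List ℕ → List ℕ := fun S => xs.filter fun i => S.any fun j => j == i || adj M j i
    with hstep
  have hmem : ∀ S i, i ∈ step S ↔ i ∈ xs ∧ ∃ j ∈ S, j = i ∨ adj M j i = true := by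
    intro S i
    simp [hstep]
  obtain ⟨r, hrX, hr0⟩ : ∃ r : Fin n, r ∈ X ∧ xs.headI = r := by
    obtain ⟨x, hx⟩ := hne
    have : xs ≠ [] := List.ne_nil_of_mem ((hX x).2 ⟨x.2, hx⟩)
    obtain ⟨a, l, rfl⟩ := List.exists_cons_of_ne_nil this
    obtain ⟨h, ha⟩ := (hX a).1 (by simp)
    exact ⟨⟨a, h⟩, ha, rfl⟩
  rw [hr0] at hr
  have hcard : X.card ≤ xs.length := by
    rw [← Finset.card_map Fin.valEmbedding]
    refine (Finset.card_le_card fun i hi => ?_).trans xs.toFinset_card_le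
    obtain ⟨x, hx, rfl⟩ := Finset.mem_map.1 hi
    simpa using (hX x).2 ⟨x.2, hx⟩
  have hsound : ∀ m, ∀ i ∈ step^[m] [r.1], ∃ (h : i < n) (hi : (⟨i, h⟩ : Fin n) ∈ X),
      (G.induce (X : Set (Fin n))).Reachable ⟨r, hrX⟩ ⟨⟨i, h⟩, hi⟩ := by
    intro m
    induction m with
    | zero =>
      intro i hi
      obtain rfl : i = r := by simpa using hi
      exact ⟨r.2, hrX, .rfl⟩
    | succ m ih =>
      intro i hi
      rw [Function.iterate_succ_apply', hmem] at hi
      obtain ⟨hix, j, hj, hji⟩ := hi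
      obtain ⟨h, hi⟩ := (hX i).1 hix
      obtain ⟨h', hj', hreach⟩ := ih j hj
      refine ⟨h, hi, ?_⟩
      rcases hji with rfl | hji
      · exact hreach
      · refine hreach.trans (SimpleGraph.Adj.reachable ?_)
        exact (hM ⟨j, h'⟩ ⟨i, h⟩).1 hji
  have hcomplete : ∀ (x y : (X : Set (Fin n))) (p : (G.induce (X : Set (Fin n))).Walk x y),
      y = ⟨r, hrX⟩ → ∀ m, p.length ≤ m → x.1.1 ∈ step^[m] [r.1] := by
    intro x y p hy m hm
    have hxs : ∀ x : (X : Set (Fin n)), x.1.1 ∈ xs := fun x => (hX _).2 ⟨x.1.2, x.2⟩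
    induction m generalizing x with
    | zero =>
      cases p with
      | nil => simp [hy]
      | cons => simp at hm
    | succ m ih =>
      rw [Function.iterate_succ_apply', hmem]
      refine ⟨hxs x, ?_⟩
      cases p with
      | nil => exact ⟨y.1.1, ih y .nil (by simp), .inl rfl⟩
      | @cons _ z _ h p =>
        exact ⟨z.1.1, ih z p (by simpa using hm), .inr ((hM _ _).2 h.symm)⟩
  simp only [connected, List.all_eq_true, List.any_eq_true, beq_iff_eq, exists_eq_right, hr]
  constructor
  · intro h
    have h' : ∀ x : (X : Set (Fin n)),
        (G.induce (X : Set (Fin n))).Reachable ⟨r, hrX⟩ x := fun x => by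
      obtain ⟨_, _, hx⟩ := hsound _ _ (h x.1 ((hX _).2 ⟨x.1.2, x.2⟩))
      exact hx
    have : Nonempty (X : Set (Fin n)) := ⟨⟨r, hrX⟩⟩
    exact ⟨fun x y => (h' x).symm.trans (h' y)⟩
  · intro h i hi
    obtain ⟨hn, hi⟩ := (hX i).1 hi
    obtain ⟨p, hp⟩ := (h.preconnected ⟨⟨i, hn⟩, hi⟩ ⟨r, hrX⟩).exists_isPath
    refine hcomplete _ _ p rfl _ ?_
    have := hp.length_lt
    simp only [Finset.coe_sort_coe, Fintype.card_coe] at this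
    omega

end Correctness

/-! ### The reduction and the lifting algorithm on instances -/

open Classical in
/-- The adjacency matrix. -/
noncomputable def FinGraph.matrix (G : FinGraph) : List (List Bool) :=
  List.ofFn fun i => List.ofFn fun j => decide (G.graph.Adj i j)

theorem FinGraph.enc_matrix (G : FinGraph) : enc G.matrix = enc G := by
  simp [enc, FinGraph.matrix, List.map_ofFn, Function.comp_def]

theorem FinGraph.length_matrix (G : FinGraph) : G.matrix.length = G.n := by
  simp [FinGraph.matrix]

theorem entry_ofFn {β : Type} [Inhabited β] {n : ℕ} (f : Fin n → β) (i : Fin n) :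
    entry (List.ofFn f) i = f i := by
  unfold entry
  rw [List.drop_eq_getElem_cons (by simp)]
  simp

theorem FinGraph.adj_matrix (G : FinGraph) (i j : Fin G.n) :
    adj G.matrix i j = true ↔ G.graph.Adj i j := by
  rw [adj, FinGraph.matrix, entry_ofFn, entry_ofFn]
  simp

/-- The characteristic vector. -/
def bits {n : ℕ} (S : Finset (Fin n)) : List Bool := List.ofFn fun i => decide (i ∈ S)

theorem enc_bits {n : ℕ} (S : Finset (Fin n)) : enc (bits S) = enc S := by
  simp [enc, bits, List.map_ofFn, Function.comp_def]

theorem entry_bits {n : ℕ} (S : Finset (Fin n)) (i : Fin n) :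
    entry (bits S) i = true ↔ i ∈ S := by
  rw [bits, entry_ofFn]
  simp

theorem length_filter_bits {n : ℕ} (S : Finset (Fin n)) :
    ((bits S).filter fun b => b).length = S.card := by
  rw [bits, List.ofFn_eq_map, List.filter_map, List.length_map,
    ← List.toFinset_card_of_nodup ((List.nodup_finRange n).filter _)]
  congr 1
  ext i
  simp

/-- The characteristic vector of an optional set, as a list of length at most one. -/
def optBits {n : ℕ} : Option (Finset (Fin n)) → List (List Bool)
  | none => []
  | some Z => [bits Z]

theorem enc_optBits {n : ℕ} (o : Option (Finset (Fin n))) : enc (optBits o) = enc o := by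
  cases o with
  | none => rfl
  | some Z => exact congrArg (Data.cons · Data.nil) (enc_bits Z)

/-- The graph induced by the entries of a list of vertices. -/
def FinGraph.induced (G : FinGraph) (vs : List ℕ) (h : ∀ v ∈ vs, v < G.n) : FinGraph where
  n := vs.length
  graph := G.graph.comap fun a => ⟨vs[a], h _ (List.getElem_mem _)⟩

/-- The graph induced by a list without repetitions is an induced subgraph. -/
def FinGraph.inducedEmbedding (G : FinGraph) (vs : List ℕ) (h : ∀ v ∈ vs, v < G.n)
    (hvs : vs.Nodup) : (G.induced vs h).graph ↪g G.graph :=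
  SimpleGraph.Embedding.comap
    ⟨fun a : Fin vs.length => (⟨vs[a], h _ (List.getElem_mem _)⟩ : Fin G.n), fun a b hab => by
      simpa [Fin.ext_iff, hvs.getElem_inj_iff] using hab⟩ G.graph

theorem FinGraph.matrix_induced (G : FinGraph) (vs : List ℕ) (h : ∀ v ∈ vs, v < G.n) :
    (G.induced vs h).matrix = subMatrix G.matrix vs := by
  have key : ∀ {β : Type} (f : ℕ → β),
      vs.map f = List.ofFn fun a : Fin vs.length => f vs[a] := by
    intro β f
    refine List.ext_getElem (by simp) fun i h1 h2 => by simp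
  classical
  rw [subMatrix, key]
  refine congrArg _ (funext fun a => ?_)
  rw [key]
  refine congrArg _ (funext fun b => ?_)
  rw [Bool.eq_iff_iff, decide_eq_true_iff]
  exact (G.adj_matrix _ _).symm

theorem redVerts_lt {t : ℕ} {M o : List (List Bool)} {v : ℕ} (h : v ∈ redVerts t M o) :
    v < M.length := by
  unfold redVerts keptVerts at h
  cases h' : useful t M o <;> rw [h'] at h <;>
    exact List.mem_range.1 (List.mem_filter.1 h).1

theorem nodup_redVerts (t : ℕ) (M o : List (List Bool)) : (redVerts t M o).Nodup := by
  unfold redVerts keptVerts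
  cases useful t M o <;> exact List.nodup_range.filter _

variable (t : ℕ) (A : (I : Instance) → Option (Finset (Fin I.G.n)))

/-- The vertices of the reduced graph, for lists of length up to `t` and the core algorithm `A`. -/
noncomputable def Instance.redVerts (I : Instance) : List ℕ :=
  LossyCDS.redVerts t I.G.matrix (optBits (A I))

theorem Instance.redVerts_lt (I : Instance) : ∀ v ∈ I.redVerts t A, v < I.G.n := fun _ h =>
  (LossyCDS.redVerts_lt h).trans_eq I.G.length_matrix

/-- The reduction algorithm: the parameter is kept. -/
noncomputable def reduction (I : Instance) : Instance where
  G := I.G.induced (I.redVerts t A) (I.redVerts_lt t A)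
  k := I.k

/-- The reduced graph as an induced subgraph of the original one. -/
noncomputable def reductionEmbedding (I : Instance) : (reduction t A I).G.graph ↪g I.G.graph :=
  I.G.inducedEmbedding _ (I.redVerts_lt t A) (nodup_redVerts _ _ _)

/-- The solution lifting algorithm. -/
noncomputable def lifting (x : LiftInput) : Finset (Fin x.orig.G.n) :=
  Finset.univ.filter fun i =>
    lifted t x.orig.G.matrix (optBits (A x.orig)) x.orig.k (bits x.sol) i = true

variable {t A}

theorem mem_lifting {x : LiftInput} {i : Fin x.orig.G.n} :
    i ∈ lifting t A x ↔
      lifted t x.orig.G.matrix (optBits (A x.orig)) x.orig.k (bits x.sol) i = true :=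
  Finset.mem_filter.trans (and_iff_right (Finset.mem_univ i))

theorem polyOn_core {D : Set Instance} (hA : PolyTimeOn D A) :
    PolyOn D fun I => (((I.G.matrix, I.k) : List (List Bool) × ℕ), optBits (A I)) := by
  refine PolyOn.pair ?_ ?_
  · refine Poly.on (.of_enc_eq fun I => ?_) _
    rw [enc_pair, FinGraph.enc_matrix]
    rfl
  · obtain ⟨c, p, h⟩ := hA
    refine ⟨c, p, fun I hI => ?_⟩
    rw [enc_optBits]
    exact h I hI

theorem polyTimeOn_reduction {D : Set Instance} (hA : PolyTimeOn D A) :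
    PolyTimeOn D (reduction t A) := by
  have h1 : Poly fun x : (List (List Bool) × ℕ) × List (List Bool) =>
      (subMatrix x.1.1 (redVerts t x.1.1 x.2), x.1.2) := by fun_prop
  obtain ⟨c, p, h⟩ := PolyOn.comp h1 (polyOn_core hA) (Set.mapsTo_univ _ _)
  refine ⟨c, p, fun I hI => ?_⟩
  have h2 : enc (reduction t A I) =
      enc (subMatrix I.G.matrix (redVerts t I.G.matrix (optBits (A I))), I.k) := by
    rw [enc_pair]
    refine congrArg (Data.cons · _) ?_
    rw [← FinGraph.enc_matrix]
    exact congrArg enc (I.G.matrix_induced _ (I.redVerts_lt t A))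
  rw [h2]
  exact h I hI

theorem polyTimeOn_lifting {D : Set Instance} (hA : PolyTimeOn D A) :
    PolyTimeOn {x : LiftInput | x.orig ∈ D ∧ x.red = reduction t A x.orig} (lifting t A) := by
  have horig : PolyOn {x : LiftInput | x.orig ∈ D ∧ x.red = reduction t A x.orig}
      LiftInput.orig := .of_hd fun _ _ => rfl
  have hsol : PolyOn {x : LiftInput | x.orig ∈ D ∧ x.red = reduction t A x.orig}
      fun x => bits x.sol := by
    have h1 : Poly fun x : LiftInput => (x.orig, x.red, bits x.sol) := .of_enc_eq fun x => by
      rw [enc_pair, enc_pair, enc_bits]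
      rfl
    exact h1.snd.snd.on _
  have h1 : Poly fun x : ((List (List Bool) × ℕ) × List (List Bool)) × List Bool =>
      (List.range x.1.1.1.length).map fun i => lifted t x.1.1.1 x.1.2 x.1.1.2 x.2 i := by fun_prop
  obtain ⟨c, p, h⟩ := PolyOn.comp h1
    ((PolyOn.comp (polyOn_core hA) horig fun x hx => hx.1).pair hsol) (Set.mapsTo_univ _ _)
  refine ⟨c, p, fun x hx => ?_⟩
  have h2 : enc (lifting t A x) = enc ((List.range x.orig.G.matrix.length).map fun i =>
      lifted t x.orig.G.matrix (optBits (A x.orig)) x.orig.k (bits x.sol) i) := by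
    rw [← enc_bits, x.orig.G.length_matrix]
    refine congrArg enc (List.ext_getElem (by simp [bits]) fun i h1 h2 => ?_)
    rw [List.getElem_map, List.getElem_range, Bool.eq_iff_iff]
    simp only [bits, List.getElem_ofFn, decide_eq_true_iff]
    exact mem_lifting
  rw [h2]
  exact h x hx

/-! ### Connected dominating sets of the reduced graph -/

theorem conn_map_iff {V W : Type} {G : SimpleGraph V} {H : SimpleGraph W} (f : H ↪g G)
    (S : Finset W) : Conn G (S.map f.toEmbedding) ↔ Conn H S := by
  have e : H.induce (S : Set W) ≃g G.induce ((S.map f.toEmbedding : Finset V) : Set V) :=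
    { toEquiv := (Equiv.Set.image f S f.injective).trans
        (Equiv.setCongr (by simp))
      map_rel_iff' := by
        intro a b
        exact f.map_adj_iff }
  exact e.symm.connected_iff

theorem dominates_map_iff {V W : Type} {G : SimpleGraph V} {H : SimpleGraph W} (f : H ↪g G)
    (S T : Finset W) :
    Dominates G (S.map f.toEmbedding) (T.map f.toEmbedding) ↔ Dominates H S T := by
  have h1 : ∀ a, f.toEmbedding a = f a := fun _ => rfl
  simp [Dominates, h1, f.map_adj_iff, f.injective.eq_iff]

theorem IsCDS.univ {V : Type} [Fintype V] {G : SimpleGraph V} {D : Finset V} (h : IsCDS G D) :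
    IsCDS G Finset.univ := by
  classical
  refine ⟨?_, fun v _ => .inl (Finset.mem_univ v)⟩
  have : Conn G (D ∪ Finset.univ) := Conn.union_of_adj h.1 fun x _ => by
    rcases h.2 x (Finset.mem_univ x) with h | ⟨u, hu, h⟩
    · exact ⟨x, h, .inl rfl⟩
    · exact ⟨u, hu, .inr h⟩
  rwa [Finset.union_eq_right.2 (Finset.subset_univ D)] at this

theorem IsCDS.nonempty {V : Type} [Fintype V] {G : SimpleGraph V} {D : Finset V}
    (h : IsCDS G D) : D.Nonempty := by
  obtain ⟨v, hv⟩ := h.1.nonempty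
  exact ⟨v, hv⟩

variable {t : ℕ} {A : (I : Instance) → Option (Finset (Fin I.G.n))} {I : Instance}

theorem mem_coreList_matrix {Z : Finset (Fin I.G.n)} (hZ : A I = some Z) (i : ℕ) :
    i ∈ coreList I.G.matrix (optBits (A I)) ↔ ∃ h : i < I.G.n, ⟨i, h⟩ ∈ Z := by
  rw [hZ]
  exact mem_coreList (o := optBits (some Z)) I.G.length_matrix (entry_bits Z) i

variable (t A I) in
/-- The core and the lists that are kept, as a set of vertices. -/
noncomputable def Instance.keptSet : Finset (Fin I.G.n) :=
  Finset.univ.filter fun i =>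
    i.1 ∈ keptVerts t I.G.matrix (coreList I.G.matrix (optBits (A I)))

theorem mem_keptVerts_iff (i : ℕ) :
    i ∈ keptVerts t I.G.matrix (coreList I.G.matrix (optBits (A I))) ↔
      ∃ h : i < I.G.n, ⟨i, h⟩ ∈ I.keptSet t A := by
  simp only [Instance.keptSet, Finset.mem_filter, Finset.mem_univ, true_and, exists_prop]
  refine ⟨fun h => ⟨?_, h⟩, fun h => h.2⟩
  rw [← I.G.length_matrix]
  exact List.mem_range.1 (List.mem_filter.1 h).1

theorem subset_keptSet {Z : Finset (Fin I.G.n)} (hZ : A I = some Z) : Z ⊆ I.keptSet t A := by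
  intro z hz
  refine ((mem_keptVerts_iff z.1).1 ?_).2
  refine List.mem_filter.2 ⟨by simp [I.G.length_matrix], ?_⟩
  have := (mem_coreList_matrix hZ z).2 ⟨z.2, hz⟩
  simp [this]

theorem exists_twins_keptSet {Z : Finset (Fin I.G.n)} (hZ : A I = some Z)
    {l : List (Fin I.G.n)} (hl : IsConnList I.G.graph l) (hlen : l.length ≤ t) :
    ∃ l', IsConnList I.G.graph l' ∧ (∀ x ∈ l', x ∈ I.keptSet t A) ∧
      List.Forall₂ (Twins I.G.graph Z) l l' := by
  rcases eq_or_ne l [] with rfl | hne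
  · exact ⟨[], trivial, by simp, .nil⟩
  obtain ⟨l', hc, hk, ht⟩ := exists_keptLists I.G.length_matrix I.G.adj_matrix
    (mem_coreList_matrix hZ) hl hne hlen
  refine ⟨l', hc, fun x hx => ((mem_keptVerts_iff x.1).1 ?_).2, ht⟩
  refine List.mem_filter.2 ⟨by simp [I.G.length_matrix], ?_⟩
  rw [Bool.or_eq_true, List.any_eq_true (l := keptLists _ _ _)]
  exact .inr ⟨_, hk, List.any_eq_true.2 ⟨x, List.mem_map_of_mem hx, beq_self_eq_true _⟩⟩

theorem useful_iff {Z : Finset (Fin I.G.n)} (hZ : A I = some Z) (hne : (I.keptSet t A).Nonempty) :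
    useful t I.G.matrix (optBits (A I)) = true ↔ Conn I.G.graph (I.keptSet t A) := by
  rw [← connected_iff I.G.adj_matrix mem_keptVerts_iff hne, useful]
  simp [hZ, optBits]

/-- A core of a graph with a connected dominating set is not empty. -/
theorem nonempty_of_isDomCore {V : Type} [Fintype V] {G : SimpleGraph V} {k : ℕ} {D Z : Finset V}
    (hD : IsCDS G D) (hZ : IsDomCore G k Z) : Z.Nonempty := by
  rw [Finset.nonempty_iff_ne_empty]
  rintro rfl
  obtain ⟨v, -⟩ := hD.nonempty
  simpa using hZ ∅ (by simp) (by simp [Dominates]) v (Finset.mem_univ v)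

/-- If there is a connected dominating set of size at most `k`, then the connectivity test
succeeds. -/
theorem useful_of_card_le {Z D : Finset (Fin I.G.n)} (hZ : A I = some Z)
    (hcore : IsDomCore I.G.graph I.k Z) (ht : 1 ≤ t) (hD : IsCDS I.G.graph D)
    (hDk : D.card ≤ I.k) : useful (4 * t) I.G.matrix (optBits (A I)) = true := by
  have hsub := subset_keptSet (t := 4 * t) hZ
  rw [useful_iff hZ ((nonempty_of_isDomCore hD hcore).mono hsub)]
  obtain ⟨D', m, hX, hD', -, -⟩ := exists_isCDS_subset hcore hsub
    (fun l h1 h2 => exists_twins_keptSet hZ h1 h2) ht hD hDk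
  rw [← Finset.union_eq_right.2 hX]
  refine Conn.union_of_adj hD'.1 fun x _ => ?_
  rcases hD'.2 x (Finset.mem_univ x) with h | ⟨u, hu, h⟩
  · exact ⟨x, h, .inl rfl⟩
  · exact ⟨u, hu, .inr h⟩

variable (t A I) in
theorem mem_map_univ (i : Fin I.G.n) :
    i ∈ Finset.univ.map (reductionEmbedding t A I).toEmbedding ↔ i.1 ∈ I.redVerts t A := by
  simp only [Finset.mem_map, Finset.mem_univ, true_and]
  constructor
  · rintro ⟨a, rfl⟩
    exact List.getElem_mem (l := I.redVerts t A) a.2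
  · intro h
    obtain ⟨a, ha, h⟩ := List.getElem_of_mem h
    exact ⟨⟨a, ha⟩, Fin.ext h⟩

theorem map_univ_of_useful (hu : useful t I.G.matrix (optBits (A I)) = true) :
    Finset.univ.map (reductionEmbedding t A I).toEmbedding = I.keptSet t A := by
  ext i
  rw [mem_map_univ, Instance.redVerts, LossyCDS.redVerts, hu, cond_true, mem_keptVerts_iff]
  exact ⟨fun h => h.2, fun h => ⟨i.2, h⟩⟩

/-- In the case without a useful core, the reduced graph has at most one vertex. -/
theorem length_redVerts_le_one (hu : useful t I.G.matrix (optBits (A I)) = false) :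
    (I.redVerts t A).length ≤ 1 := by
  have h1 := nodup_redVerts t I.G.matrix (optBits (A I))
  have h2 : I.redVerts t A ⊆ [0] := by
    intro i hi
    rw [Instance.redVerts, LossyCDS.redVerts, hu, cond_false, List.mem_filter] at hi
    simpa using hi.2
  exact (List.subperm_of_subset h1 h2).length_le

theorem useful_of_none (h : A I = none) : useful t I.G.matrix (optBits (A I)) = false := by
  simp [useful, optBits, h]

theorem isCDS_univ_reduction {D : Finset (Fin I.G.n)} (hD : IsCDS I.G.graph D)
    (hcore : ∀ Z, A I = some Z → IsDomCore I.G.graph I.k Z) :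
    IsCDS (reduction t A I).G.graph Finset.univ := by
  refine ⟨?_, fun v _ => .inl (Finset.mem_univ v)⟩
  refine (conn_map_iff (reductionEmbedding t A I) Finset.univ).1 ?_
  cases hu : useful t I.G.matrix (optBits (A I))
  · -- the only vertex is the first one
    obtain ⟨v, -⟩ := hD.nonempty
    have : Finset.univ.map (reductionEmbedding t A I).toEmbedding =
        {(⟨0, Nat.zero_lt_of_lt v.2⟩ : Fin I.G.n)} := by
      ext i
      rw [mem_map_univ, Instance.redVerts, LossyCDS.redVerts, hu, cond_false]
      simp [Fin.ext_iff, I.G.length_matrix]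
    rw [this]
    exact conn_singleton _
  · rw [map_univ_of_useful hu]
    cases hZ : A I with
    | none => simp [useful_of_none hZ] at hu
    | some Z =>
      exact (useful_iff hZ ((nonempty_of_isDomCore hD (hcore Z hZ)).mono (subset_keptSet hZ))).1 hu

/-- The reduced graph has connected dominating sets that are almost as small as those of the
original graph. -/
theorem exists_isCDS_reduction {Z D : Finset (Fin I.G.n)} (hZ : A I = some Z)
    (hcore : IsDomCore I.G.graph I.k Z) (ht : 1 ≤ t) (hD : IsCDS I.G.graph D)
    (hDk : D.card ≤ I.k) :
    ∃ (S : Finset (Fin (reduction (4 * t) A I).G.n)) (m : ℕ),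
      IsCDS (reduction (4 * t) A I).G.graph S ∧ m * t ≤ D.card ∧ S.card ≤ D.card + 5 * m := by
  obtain ⟨D', m, hX, hD', hm, hcard⟩ := exists_isCDS_subset hcore (subset_keptSet hZ)
    (fun l h1 h2 => exists_twins_keptSet (t := 4 * t) hZ h1 h2) ht hD hDk
  rw [← map_univ_of_useful (useful_of_card_le hZ hcore ht hD hDk)] at hX
  obtain ⟨S, -, rfl⟩ := Finset.subset_map_iff.1 hX
  refine ⟨S, m, ⟨(conn_map_iff _ S).1 hD'.1, ?_⟩, hm, by simpa using hcard⟩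
  rw [← dominates_map_iff (reductionEmbedding (4 * t) A I)]
  exact fun v _ => hD'.2 v (Finset.mem_univ v)

/-- Small solutions of a useful reduced instance are not changed by the lifting. -/
theorem lifting_eq_map {S : Finset (Fin (reduction t A I).G.n)}
    (hu : useful t I.G.matrix (optBits (A I)) = true) (hS : S.card ≤ I.k) :
    lifting t A ⟨I, reduction t A I, S⟩ = S.map (reductionEmbedding t A I).toEmbedding := by
  ext i
  rw [mem_lifting, lifted, hu, length_filter_bits, decide_eq_true hS, Bool.and_true, cond_true,
    List.any_eq_true, Finset.mem_map]
  simp only [List.mem_range, Bool.and_eq_true, beq_iff_eq]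
  have key : ∀ a : Fin (reduction t A I).G.n,
      entry (redVerts t I.G.matrix (optBits (A I))) a = (reductionEmbedding t A I a).1 := by
    intro a
    have ha : (a : ℕ) < (redVerts t I.G.matrix (optBits (A I))).length := a.2
    rw [entry, List.drop_eq_getElem_cons ha]
    rfl
  constructor
  · rintro ⟨a, ha, h1, h2⟩
    refine ⟨⟨a, ha⟩, (entry_bits S ⟨a, ha⟩).1 h1, Fin.ext ?_⟩
    rw [← h2]
    exact (key ⟨a, ha⟩).symm
  · rintro ⟨a, ha, rfl⟩
    exact ⟨a, a.2, (entry_bits S a).2 ha, key a⟩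

theorem lifting_eq_univ {S : Finset (Fin (reduction t A I).G.n)}
    (h : useful t I.G.matrix (optBits (A I)) = true → I.k < S.card) :
    lifting t A ⟨I, reduction t A I, S⟩ = Finset.univ := by
  ext i
  rw [mem_lifting, lifted, length_filter_bits]
  cases hu : useful t I.G.matrix (optBits (A I))
  · simp
  · simp [(h hu).not_ge]

/-! ### The approximation ratio -/

theorem value_of_isCDS {I : Instance} {S : Finset (Fin I.G.n)} (h : IsCDS I.G.graph S) :
    value CDS I S = ((min S.card (I.k + 1) : ℕ) : ENNReal) := if_pos h

theorem value_of_not_isCDS {I : Instance} {S : Finset (Fin I.G.n)} (h : ¬ IsCDS I.G.graph S) :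
    value CDS I S = ⊤ := if_neg h

theorem one_le_value {I : Instance} (S : Finset (Fin I.G.n)) : 1 ≤ value CDS I S := by
  by_cases h : IsCDS I.G.graph S
  · rw [value_of_isCDS h]
    have := h.nonempty.card_pos
    exact_mod_cast (by omega : 1 ≤ min S.card (I.k + 1))
  · rw [value_of_not_isCDS h]
    exact le_top

theorem value_univ_le {I : Instance} {D : Finset (Fin I.G.n)} (h : IsCDS I.G.graph D) :
    value CDS I Finset.univ ≤ ((I.k + 1 : ℕ) : ENNReal) := by
  rw [value_of_isCDS h.univ]
  exact_mod_cast min_le_right _ _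

/-- The lifted solution is no more expensive than the given one if the reduced instance is
useful. -/
theorem value_lifting_le {Z D : Finset (Fin I.G.n)} (hD : IsCDS I.G.graph D) (hZ : A I = some Z)
    (hcore : IsDomCore I.G.graph I.k Z)
    (hu : useful t I.G.matrix (optBits (A I)) = true) (S : Finset (Fin (reduction t A I).G.n)) :
    value CDS I (lifting t A ⟨I, reduction t A I, S⟩) ≤ value CDS (reduction t A I) S := by
  by_cases hS : IsCDS (reduction t A I).G.graph S
  · by_cases hk : S.card ≤ I.k
    · rw [lifting_eq_map hu hk, value_of_isCDS hS, value_of_isCDS, Finset.card_map]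
      · rfl
      · refine ⟨(conn_map_iff _ S).2 hS.1, hcore _ (by simpa using hk) fun z hz => ?_⟩
        have h1 := (dominates_map_iff (reductionEmbedding t A I) S Finset.univ).2 hS.2
        rw [map_univ_of_useful hu] at h1
        exact h1 z (subset_keptSet hZ hz)
    · rw [lifting_eq_univ fun _ => not_le.1 hk, value_of_isCDS hS]
      refine (value_univ_le hD).trans ?_
      have : (reduction t A I).k = I.k := rfl
      exact_mod_cast (by omega : I.k + 1 ≤ min S.card ((reduction t A I).k + 1))
  · rw [value_of_not_isCDS hS]
    exact le_top

/-- The optimum of a useful reduced instance is at most `1 + ε` times the original one. -/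
theorem opt_reduction_le {Z : Finset (Fin I.G.n)} (hZ : A I = some Z)
    (hcore : IsDomCore I.G.graph I.k Z) {ε : ℝ} (hε : 0 < ε) {N : ℕ} (hN : 1 ≤ N)
    (hεN : 1 / ε ≤ N) :
    opt CDS (reduction (4 * (5 * N)) A I) ≤ ENNReal.ofReal (1 + ε) * opt CDS I := by
  obtain ⟨D, hDopt⟩ := exists_eq_ciInf_of_finite (f := fun S => value CDS I S)
  have hDopt : opt CDS I = value CDS I D := hDopt.symm
  have h1 : 1 ≤ ENNReal.ofReal (1 + ε) := by simpa using hε.le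
  by_cases hD : IsCDS I.G.graph D
  · rw [hDopt, value_of_isCDS hD]
    by_cases hk : D.card ≤ I.k
    · obtain ⟨S, m, hS, hm, hcard⟩ :=
        exists_isCDS_reduction (t := 5 * N) hZ hcore (by omega) hD hk
      refine (iInf_le _ S).trans ?_
      rw [value_of_isCDS hS, min_eq_left (by omega : D.card ≤ I.k + 1)]
      refine (Nat.cast_le.2 (min_le_left _ _)).trans ?_
      rw [← ENNReal.ofReal_natCast, ← ENNReal.ofReal_natCast D.card,
        ← ENNReal.ofReal_mul (by positivity)]
      refine ENNReal.ofReal_le_ofReal ?_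
      have h2 : (S.card : ℝ) ≤ D.card + 5 * m := by exact_mod_cast hcard
      have h3 : (m : ℝ) * (5 * N) ≤ D.card := by exact_mod_cast hm
      have h4 : 1 ≤ N * ε := by rwa [div_le_iff₀ hε] at hεN
      have h5 : (5 * m : ℝ) * 1 ≤ 5 * m * (N * ε) := by gcongr
      have h6 : (m : ℝ) * (5 * N) * ε ≤ D.card * ε := by gcongr
      linarith
    · refine (iInf_le _ Finset.univ).trans ?_
      refine (value_univ_le (isCDS_univ_reduction hD fun Z' hZ' => ?_)).trans ?_
      · rw [hZ] at hZ'
        cases hZ'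
        exact hcore
      · rw [min_eq_right (by omega)]
        exact le_mul_of_one_le_left' h1
  · rw [hDopt, value_of_not_isCDS hD, ENNReal.mul_top (by positivity)]
    exact le_top

theorem isApproxPreprocessing {𝒞 : Set FinGraph} (hA : IsCoreAlgorithm 𝒞 A) {ε : ℝ} (hε : 0 < ε)
    {N : ℕ} (hN : 1 ≤ N) (hεN : 1 / ε ≤ N) :
    IsApproxPreprocessing CDS 𝒞 (1 + ε) (reduction (4 * (5 * N)) A)
      (lifting (4 * (5 * N)) A) := by
  refine ⟨polyTimeOn_reduction hA.1, polyTimeOn_lifting hA.1, fun I hI S => ?_⟩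
  have hcore := (hA.2 I hI).2
  have h1 : 1 ≤ ENNReal.ofReal (1 + ε) := by simpa using hε.le
  by_cases hG : ∃ D, IsCDS I.G.graph D
  swap
  · have : opt CDS I = ⊤ := iInf_eq_top.2 fun D => value_of_not_isCDS fun h => hG ⟨D, h⟩
    simp [this]
  obtain ⟨D, hD⟩ := hG
  cases hu : useful (4 * (5 * N)) I.G.matrix (optBits (A I))
  · -- all connected dominating sets are larger than `k`
    have hlarge : ∀ D, IsCDS I.G.graph D → I.k < D.card := by
      intro D hD
      by_contra hk
      rw [not_lt] at hk
      cases hZ : A I with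
      | none =>
        have h2 := (hA.2 I hI).1 hZ
        have h3 : cds I.G.graph ≤ D.card :=
          iInf_le (fun D : {D // IsCDS I.G.graph D} => (D.1.card : ℕ∞)) ⟨D, hD⟩
        have : (I.k : ℕ∞) < D.card := h2.trans_le h3
        exact hk.not_gt (by exact_mod_cast this)
      | some Z =>
        rw [useful_of_card_le hZ (hcore Z hZ) (by omega) hD hk] at hu
        cases hu
    have hopt : ((I.k + 1 : ℕ) : ENNReal) ≤ opt CDS I := le_iInf fun D => by
      by_cases h : IsCDS I.G.graph D
      · rw [value_of_isCDS h]
        have := hlarge D h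
        exact_mod_cast (by omega : I.k + 1 ≤ min D.card (I.k + 1))
      · rw [value_of_not_isCDS h]
        exact le_top
    have hopt' : opt CDS (reduction (4 * (5 * N)) A I) ≠ ⊤ :=
      ((iInf_le _ Finset.univ).trans_lt ((value_univ_le
        (isCDS_univ_reduction hD hcore)).trans_lt (ENNReal.natCast_lt_top _))).ne
    have hopt0 : opt CDS (reduction (4 * (5 * N)) A I) ≠ 0 :=
      (one_pos.trans_le (le_iInf fun S => one_le_value S)).ne'
    calc _ ≤ (1 : ENNReal) := by
          rw [lifting_eq_univ (by simp [hu])]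
          exact ENNReal.div_le_of_le_mul (by simpa using (value_univ_le hD).trans hopt)
      _ ≤ value CDS (reduction (4 * (5 * N)) A I) S / opt CDS (reduction (4 * (5 * N)) A I) := by
          rw [ENNReal.le_div_iff_mul_le (.inl hopt0) (.inl hopt'), one_mul]
          exact iInf_le _ S
      _ ≤ _ := le_mul_of_one_le_left' h1
  · cases hZ : A I with
    | none => simp [useful_of_none hZ] at hu
    | some Z =>
      have hv := value_lifting_le hD hZ (hcore Z hZ) hu S
      have ho := opt_reduction_le hZ (hcore Z hZ) hε hN hεN
      calc _ ≤ value CDS (reduction (4 * (5 * N)) A I) S / opt CDS I :=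
            ENNReal.div_le_div_right hv _
        _ = ENNReal.ofReal (1 + ε) * value CDS (reduction (4 * (5 * N)) A I) S /
              (ENNReal.ofReal (1 + ε) * opt CDS I) :=
            (ENNReal.mul_div_mul_left _ _ (one_pos.trans_le h1).ne' ENNReal.ofReal_ne_top).symm
        _ = ENNReal.ofReal (1 + ε) * (value CDS (reduction (4 * (5 * N)) A I) S /
              (ENNReal.ofReal (1 + ε) * opt CDS I)) := mul_div_assoc _ _ _
        _ ≤ _ := by gcongr

/-! ### The size of the reduced graph -/

theorem exists_eval_le (p : Polynomial ℝ) {d : ℕ} (hp : p.natDegree ≤ d) :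
    ∃ P : ℕ, ∀ z : ℕ, 1 ≤ z → p.eval (z : ℝ) ≤ P * (z : ℝ) ^ d := by
  obtain ⟨P, hP⟩ := exists_nat_ge (∑ i ∈ Finset.range (d + 1), |p.coeff i|)
  refine ⟨P, fun z hz => ?_⟩
  have hz : (1 : ℝ) ≤ z := by exact_mod_cast hz
  rw [Polynomial.eval_eq_sum_range' (Nat.lt_succ_of_le hp)]
  refine le_trans ?_ (mul_le_mul_of_nonneg_right hP (by positivity))
  rw [Finset.sum_mul]
  refine Finset.sum_le_sum fun i hi => ?_
  have hi : i ≤ d := by simpa [Nat.lt_succ_iff] using hi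
  calc p.coeff i * (z : ℝ) ^ i ≤ |p.coeff i| * (z : ℝ) ^ i := by gcongr; exact le_abs_self _
    _ ≤ |p.coeff i| * (z : ℝ) ^ d := by gcongr

theorem card_quotient_le {V : Type} [Fintype V] (G : SimpleGraph V) (Z : Finset V) :
    Nat.card (Quotient (simZ G Z)) ≤ nbhdComplexity G Z.card :=
  Finset.le_sup (f := fun Z : Finset V => Nat.card (Quotient (simZ G Z)))
    (Finset.mem_powersetCard_univ.2 rfl)

theorem n_reduction_le {Z : Finset (Fin I.G.n)} (hZ : A I = some Z)
    (hcore : IsDomCore I.G.graph I.k Z) {P d T : ℕ} (hd : 1 ≤ d) (hT : 1 ≤ T)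
    (hP : 1 ≤ Z.card → nbhdComplexity I.G.graph Z.card ≤ P * Z.card ^ d) :
    (reduction T A I).G.n ≤ (4 * (P + 2) * Z.card) ^ (d * T) := by
  rcases Nat.eq_zero_or_pos Z.card with h0 | hpos
  · -- the empty core dominates only the empty graph
    have hn : I.G.n = 0 := by
      by_contra hn
      rw [Finset.card_eq_zero] at h0
      subst h0
      simpa using hcore ∅ (by simp) (by simp [Dominates]) ⟨0, by omega⟩ (Finset.mem_univ _)
    have h1 : (reduction T A I).G.n ≤ I.G.n := by
      simpa using Fintype.card_le_of_embedding (reductionEmbedding T A I).toEmbedding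
    omega
  have hbase : 1 ≤ 4 * (P + 2) * Z.card := Nat.mul_pos (by omega) hpos
  cases hu : useful T I.G.matrix (optBits (A I))
  · exact (length_redVerts_le_one hu).trans (Nat.one_le_pow _ _ hbase)
  have h1 : (reduction T A I).G.n =
      (keptVerts T I.G.matrix (coreList I.G.matrix (optBits (A I)))).length := by
    change (LossyCDS.redVerts T I.G.matrix (optBits (A I))).length = _
    rw [LossyCDS.redVerts, hu, cond_true]
  have h2 := length_keptVerts_le I.G.length_matrix I.G.adj_matrix (mem_coreList_matrix hZ) T
  have h3 := (card_quotient_le I.G.graph Z).trans (hP hpos)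
  set q := Z.card + Nat.card (Quotient (simZ I.G.graph Z)) + 1 with hq
  have h4 : Z.card ≤ Z.card ^ d := Nat.le_self_pow (by omega) _
  have h5 : q ≤ (P + 2) * Z.card ^ d := by
    have : 1 ≤ Z.card ^ d := Nat.one_le_pow _ _ hpos
    rw [add_mul]
    omega
  have h6 : Z.card ≤ q ^ T := (by omega : Z.card ≤ q).trans (Nat.le_self_pow (by omega) _)
  have h7 : 1 + T * T ≤ 4 ^ T := by
    have h8 : T + 1 ≤ 2 ^ T := Nat.lt_two_pow_self
    have h9 : (4 : ℕ) ^ T = 2 ^ T * 2 ^ T := by rw [← mul_pow]; norm_num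
    rw [h9]
    nlinarith
  calc (reduction T A I).G.n ≤ q ^ T + T * (T * q ^ T) := by omega
    _ = (1 + T * T) * q ^ T := by ring
    _ ≤ 4 ^ T * ((P + 2) * Z.card ^ d) ^ T := by gcongr
    _ = (4 * (P + 2) * Z.card ^ d) ^ T := by rw [← mul_pow, mul_assoc]
    _ ≤ ((4 * (P + 2)) ^ d * Z.card ^ d) ^ T := by
        gcongr
        exact Nat.le_self_pow (by omega) _
    _ = (4 * (P + 2) * Z.card) ^ (d * T) := by rw [← mul_pow, pow_mul]

end LossyCDS

theorem theorem1 :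
    ∃ c : ℕ, ∀ (d : ℕ) (p : Polynomial ℝ), 1 ≤ d → p.natDegree ≤ d →
      ∃ K : ℕ, ∀ 𝒞 : Set LossyCDS.FinGraph,
        (∀ G ∈ 𝒞, ∀ z : ℕ, (LossyCDS.nbhdComplexity G.graph z : ℝ) ≤ p.eval (z : ℝ)) →
        ∀ A : (I : LossyCDS.Instance) → Option (Finset (Fin I.G.n)),
          LossyCDS.IsCoreAlgorithm 𝒞 A →
          ∀ ε : ℝ, 0 < ε →
            ∃ (R : LossyCDS.Instance → LossyCDS.Instance)
              (L : (x : LossyCDS.LiftInput) → Finset (Fin x.orig.G.n)),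
              LossyCDS.IsApproxPreprocessing LossyCDS.CDS 𝒞 (1 + ε) R L ∧
              ∀ I : LossyCDS.Instance, I.G ∈ 𝒞 →
                Nonempty ((R I).G.graph ↪g I.G.graph) ∧ (R I).k ≤ I.k ∧
                (A I = none → (R I).G.n ≤ 1) ∧
                (∀ Z, A I = some Z →
                  (R I).G.n ≤ (K * Z.card) ^ (c * d * ⌈1 / ε⌉₊)) := by
  refine ⟨20, fun d p hd hp => ?_⟩
  obtain ⟨P, hP⟩ := LossyCDS.exists_eval_le p hp
  refine ⟨4 * (P + 2), fun 𝒞 h𝒞 A hA ε hε => ?_⟩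
  have hN : 1 ≤ ⌈1 / ε⌉₊ := Nat.ceil_pos.2 (by positivity)
  refine ⟨LossyCDS.reduction (4 * (5 * ⌈1 / ε⌉₊)) A, LossyCDS.lifting (4 * (5 * ⌈1 / ε⌉₊)) A,
    LossyCDS.isApproxPreprocessing hA hε hN (Nat.le_ceil _), fun I hI =>
      ⟨⟨LossyCDS.reductionEmbedding _ A I⟩, le_rfl, fun h => ?_, fun Z hZ => ?_⟩⟩
  · exact LossyCDS.length_redVerts_le_one (LossyCDS.useful_of_none h)
  · have h1 := LossyCDS.n_reduction_le (T := 4 * (5 * ⌈1 / ε⌉₊)) hZ ((hA.2 I hI).2 Z hZ) hd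
      (by omega) (P := P) fun hz => by exact_mod_cast (h𝒞 _ hI _).trans (hP _ hz)
    rwa [show 20 * d * ⌈1 / ε⌉₊ = d * (4 * (5 * ⌈1 / ε⌉₊)) by ring]
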